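/- **Classification of optimal linear anticodes.** Let $\mathbb F$ be any field, and let $t\ge 1$ and $1\le n_i\le m_i$ $(1\le i\le t)$ be integers with $m_1\ge\dots\ge m_t$. Put $N=\sum_{i=1}^t n_i$ and $\Pi=\bigoplus_{i=1}^t\mathbb F^{n_i\times m_i}$, with the metric $(X,Y)\mapsto \mathrm{srk}(X-Y)$, where $\mathrm{srk}(X)=\sum_{i=1}^t \mathrm{rk}(X_i)$. For $0\le r\le N$, a linear $r$-anticode is a subspace $A\le\Pi$ with $\mathrm{srk}(X-Y)\le r$ for all $X,Y\in A$; it is called optimal if $$\dim A=\max\Big\{\sum_{i=1}^t m_iu_i \;\Big|\; u_i\in\mathbb Z,\ 0\le u_i\le n_i,\ \sum_{i=1}^t u_i=r\Big\}.$$ Let $\mathcal A_r(\Pi)$ be the set of all optimal linear $r$-anticodes in $\Pi$. The case $t=1$ gives the optimal linear anticodes in $\mathbb F^{n\times m}$ with the rank metric; the case where $n_i=m_i=1$ for all $i$ gives those in $\mathbb F^k$ with the Hamming metric. Let $0\le r<N$. There are unique integers $j\in\{1,\dots,t\}$ and $0\le\delta<n_j$ with $r=\sum_{i=1}^{j-1}n_i+\delta$.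 Let $\ell$ and $\ell'$ be the smallest and the largest index $i$ with $m_i=m_j$. (a) If $m_j>1$, then $\mathcal A_r(\Pi)$ is the set of all spaces $$\bigoplus_{i=1}^{\ell-1}\mathbb F^{n_i\times m_i}\oplus\bigoplus_{i=\ell}^{\ell'}A_i\oplus\bigoplus_{i=\ell'+1}^{t}\{0\},$$ where each $A_i\le\mathbb F^{n_i\times m_i}$ $(\ell\le i\le\ell')$ is an optimal linear $r_i$-anticode in the rank metric for some $0\le r_i\le n_i$ such that $\sum_{i=\ell}^{\ell'}r_i=\sum_{i=\ell}^{j-1}n_i+\delta$. (b) If $m_j=1$ (so that $\ell'=t$ and $n_i=m_i=1$ for all $i\ge\ell$), then $\mathcal A_r(\Pi)$ is the set of all spaces $$\bigoplus_{i=1}^{\ell-1}\mathbb F^{n_i\times m_i}\oplus A^{\mathsf h},$$ where $A^{\mathsf h}\le\mathbb F^{t-\ell+1}$ is an optimal linear $(j-\ell)$-anticode in the Hamming metric. -/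

import Mathlib

/-- The sum-rank metric space `⨁ i, F^{n_i × m_i}` of tuples of matrices. -/
abbrev SumRankSpace (F : Type*) {ι : Type*} (n m : ι → ℕ) : Type _ :=
  (i : ι) → Matrix (Fin (n i)) (Fin (m i)) F

/-- The sum-rank of a tuple of matrices. -/
noncomputable def srk {F : Type*} [Field F] {ι : Type*} [Fintype ι] {n m : ι → ℕ}
    (X : SumRankSpace F n m) : ℕ :=
  ∑ i, (X i).rank

/-- A (possibly non-linear) `r`-anticode in the sum-rank metric. -/
def IsSumRankAnticode {F : Type*} [Field F] {ι : Type*} [Fintype ι] {n m : ι → ℕ} (r : ℕ)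
    (A : Set (SumRankSpace F n m)) : Prop :=
  A.Nonempty ∧ ∀ X ∈ A, ∀ Y ∈ A, srk (X - Y) ≤ r

/-- The numbers `∑ m_i u_i`, where `0 ≤ u_i ≤ n_i` for all `i` and `∑ u_i = r`. Their maximum
is the upper bound for the dimension of a linear `r`-anticode. -/
def boundValues {ι : Type*} [Fintype ι] (n m : ι → ℕ) (r : ℕ) : Set ℕ :=
  {k | ∃ u : ι → ℕ, (∀ i, u i ≤ n i) ∧ ∑ i, u i = r ∧ k = ∑ i, m i * u i}

/-- An optimal linear `r`-anticode in the sum-rank metric: a linear `r`-anticode whose dimension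
equals `max {∑ m_i u_i | 0 ≤ u_i ≤ n_i, ∑ u_i = r}`. -/
def IsOptimalSumRankAnticode {F : Type*} [Field F] {ι : Type*} [Fintype ι] {n m : ι → ℕ} (r : ℕ)
    (A : Submodule F (SumRankSpace F n m)) : Prop :=
  IsSumRankAnticode r (A : Set (SumRankSpace F n m)) ∧
    IsGreatest (boundValues n m r) (Module.finrank F A)

/-- The set of all optimal linear `r`-anticodes of the sum-rank metric space. -/
def optimalSumRankAnticodes (F : Type*) [Field F] {ι : Type*} [Fintype ι] (n m : ι → ℕ) (r : ℕ) :
    Set (Submodule F (SumRankSpace F n m)) :=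
  {A | IsOptimalSumRankAnticode r A}

/-- An optimal linear `r`-anticode in the rank metric on `F^{a × b}` (the case of one block). -/
def IsOptimalRankAnticode {F : Type*} [Field F] {a b : ℕ} (r : ℕ)
    (A : Submodule F (Matrix (Fin a) (Fin b) F)) : Prop :=
  (∀ X ∈ A, ∀ Y ∈ A, (X - Y).rank ≤ r) ∧
    IsGreatest (boundValues (fun _ : Fin 1 => a) (fun _ : Fin 1 => b) r) (Module.finrank F A)

open Classical in
/-- An optimal linear `r`-anticode in the Hamming metric on `F^κ` (the case where all blocks
have size `1 × 1`). -/
def IsOptimalHammingAnticode {F : Type*} [Field F] {κ : Type*} [Fintype κ] (r : ℕ)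
    (A : Submodule F (κ → F)) : Prop :=
  (∀ x ∈ A, ∀ y ∈ A, hammingDist x y ≤ r) ∧
    IsGreatest (boundValues (fun _ : κ => 1) (fun _ : κ => 1) r) (Module.finrank F A)

/-- The space `⨁_{i < l} F^{n_i × m_i} ⊕ A`, where `A ≤ F^{{i | l ≤ i}}`. It is meant for
`n_i = m_i = 1` for all `i ≥ l`; then the `1 × 1` blocks at the positions `i ≥ l` are identified
with the coordinates of a vector. -/
def fullBlocksOplusHamming {F : Type*} [Field F] {t : ℕ} (n m : Fin t → ℕ) (l : Fin t)
    (A : Submodule F ({i : Fin t // l ≤ i} → F)) : Submodule F (SumRankSpace F n m) where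
  carrier := {X | ∃ v ∈ A, ∀ (i : {i : Fin t // l ≤ i}) (a : Fin (n i)) (b : Fin (m i)),
    X i a b = v i}
  zero_mem' := ⟨0, A.zero_mem, fun _ _ _ => rfl⟩
  add_mem' := by
    rintro X Y ⟨v, hv, hX⟩ ⟨w, hw, hY⟩
    exact ⟨v + w, A.add_mem hv hw, fun i a b => by simp [hX, hY]⟩
  smul_mem' := by
    rintro c X ⟨v, hv, hX⟩
    exact ⟨c • v, A.smul_mem c hv, fun i a b => by simp [hX]⟩

/-!
The engine of the proof is a dimension bound for *affine* spaces of matrices of bounded rank, which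
holds over every field, including `𝔽₂`.

*One block.* If all elements of an affine space `f + A` of linear maps `E → V`, `dim V ≤ dim E`,
have rank at most `r`, then `dim A ≤ r * dim E` (`finrank_le_mul_of_finrank_range_le`). To see this,
take `f` of maximal rank and `v` outside its range. Either `A` contains no rank one map `y ⊗ v`, and
`A` embeds into the maps `E → V / F v`; or it contains one, and restricting to `ker y` and reducing
modulo `v` lowers the rank. Following the case of equality for linear spaces gives their
classification (`exists_mem_iff_range_le_or_le_ker`): they consist of all maps with values in a fixed
`r`-dimensional subspace, or of all maps that vanish on a fixed subspace of codimension `r`.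
Consequently, if `dim E ≥ 2`, such a space is spanned by the directions of affine lines on which the
rank is constantly `r` (`le_of_forall_line_direction_mem`). This fails for `1 × 1`
matrices, where every line with a direction other than `0` contains `0`; this is why such blocks
behave differently.

*Several blocks.* Applying the affine bound block after block shows that `X₀ + A` contains an `X` with
`dim A ≤ ∑ m_i rk(X_i)` (`exists_finrank_le_sum_mul_rank`). For an anticode, the right-hand side is at
most the maximum of `∑ m_i u_i`, which with `c = m_j` equals `c * r + ∑ (m_i - c)⁺ n_i`; complementary
slackness says where the maximum is attained. If `A` is optimal, let `P_i` be its projection to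
block `i` and `A'` the subspace of all elements of `A` that vanish in block `i`. Applying the affine
bound to cosets of `A'` shows that `P_i` is an optimal anticode of dimension `m_i p_i`, with
`p_i = n_i` if `m_i > c` and `p_i = 0` if `m_i < c` (`exists_finrank_map_proj_eq`). Moreover, let
`X + F Y` be a line in `A` with rank constantly `p_i` in block `i`. If block `i` of `Y` were not
itself in `A`, then `A' + F Y` would have one more dimension outside block `i`, and `X + A' + F Y`
would contain an element that is too large (`exists_mul_add_finrank_lt`). As the blocks of such `Y`
span `P_i` if `m_i ≥ 2`, the anticode `A` contains `P_i` (`single_apply_mem`). So `A` is the direct sum of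
its projections if `m_j ≥ 2`. If `m_j = 1`, it contains all blocks that are larger than `1 × 1`, and
what remains is an anticode in the Hamming metric.
-/

/-! ### Dimension of spaces of linear maps of bounded rank -/

theorem Submodule.finrank_map_add_finrank_inf_ker {F M N : Type*} [Field F] [AddCommGroup M]
    [Module F M] [FiniteDimensional F M] [AddCommGroup N] [Module F N]
    (A : Submodule F M) (Φ : M →ₗ[F] N) :
    Module.finrank F (A.map Φ) + Module.finrank F (A ⊓ LinearMap.ker Φ : Submodule F M) =
      Module.finrank F A := by
  have h := (Φ.domRestrict A).finrank_range_add_finrank_ker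
  rw [LinearMap.range_domRestrict, LinearMap.ker_domRestrict] at h
  rw [← h, ← Submodule.map_comap_subtype, Submodule.finrank_map_subtype_eq]

section RankOne

variable {F E V : Type*} [Field F] [AddCommGroup E] [Module F E] [AddCommGroup V] [Module F V]

/-- The space of all functionals `y` such that the rank one map `x ↦ y x • v` lies in `A`. -/
def rankOneFunctionals (A : Submodule F (E →ₗ[F] V)) (v : V) : Submodule F (Module.Dual F E) :=
  A.comap (LinearMap.smulRightₗ.flip v)

theorem mem_rankOneFunctionals {A : Submodule F (E →ₗ[F] V)} {v : V} {y : Module.Dual F E} :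
    y ∈ rankOneFunctionals A v ↔ y.smulRight v ∈ A := Iff.rfl

/-- The map that restricts a linear map to the hyperplane `ker y` and reduces it modulo `v`. -/
def compress (y : Module.Dual F E) (v : V) :
    (E →ₗ[F] V) →ₗ[F] (LinearMap.ker y →ₗ[F] V ⧸ Submodule.span F {v}) where
  toFun g := (Submodule.mkQ _ ∘ₗ g) ∘ₗ (LinearMap.ker y).subtype
  map_add' _ _ := by ext; simp
  map_smul' _ _ := by ext; simp

/-- Reduction of a linear map modulo the vector `v` of its target. -/
def reduceMod (E : Type*) [AddCommGroup E] [Module F E] (v : V) :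
    (E →ₗ[F] V) →ₗ[F] (E →ₗ[F] V ⧸ Submodule.span F {v}) :=
  LinearMap.compRight F (Submodule.mkQ (Submodule.span F {v}))

theorem reduceMod_apply (v : V) (g : E →ₗ[F] V) (x : E) :
    reduceMod E v g x = Submodule.mkQ (Submodule.span F {v}) (g x) := rfl

theorem exists_eq_smulRight {g : E →ₗ[F] V} {v : V} (hv : v ≠ 0)
    (h : ∀ x, g x ∈ Submodule.span F {v}) : ∃ y : Module.Dual F E, g = y.smulRight v := by
  obtain ⟨ψ, hψ⟩ := Module.Projective.exists_dual_eq_one F hv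
  refine ⟨ψ ∘ₗ g, LinearMap.ext fun x => ?_⟩
  obtain ⟨c, hc⟩ := Submodule.mem_span_singleton.1 (h x)
  simp [← hc, hψ]

theorem inf_ker_reduceMod_le (A : Submodule F (E →ₗ[F] V)) {v : V} (hv : v ≠ 0) :
    A ⊓ LinearMap.ker (reduceMod E v) ≤
      (rankOneFunctionals A v).map (LinearMap.smulRightₗ.flip v) := by
  rintro g ⟨hg, hg'⟩
  obtain ⟨y, rfl⟩ := exists_eq_smulRight (g := g) hv fun x => by
    have := LinearMap.congr_fun (LinearMap.mem_ker.1 hg') x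
    rwa [reduceMod_apply, LinearMap.zero_apply, Submodule.mkQ_apply,
      Submodule.Quotient.mk_eq_zero] at this
  exact ⟨y, hg, rfl⟩

variable [FiniteDimensional F E]

theorem finrank_ker_dual {y : Module.Dual F E} (hy : y ≠ 0) :
    Module.finrank F (LinearMap.ker y) + 1 = Module.finrank F E := by
  have h := y.finrank_range_add_finrank_ker
  rw [LinearMap.range_eq_top.2 (LinearMap.surjective hy), finrank_top, Module.finrank_self] at h
  omega

theorem finrank_dualAnnihilator_ker (f : E →ₗ[F] V) :
    Module.finrank F (LinearMap.ker f).dualAnnihilator =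
      Module.finrank F (LinearMap.range f) := by
  have h1 := Subspace.finrank_add_finrank_dualAnnihilator_eq (LinearMap.ker f)
  have h2 := f.finrank_range_add_finrank_ker
  omega

theorem finrank_range_reduceMod_le (v : V) (g : E →ₗ[F] V) :
    Module.finrank F (LinearMap.range (reduceMod E v g)) ≤
      Module.finrank F (LinearMap.range g) := by
  change Module.finrank F (LinearMap.range (Submodule.mkQ _ ∘ₗ g)) ≤ _
  rw [LinearMap.range_comp]
  exact Submodule.finrank_map_le _ _

/-- If no element of `f + A` has larger rank than `f`, and `v` lies outside the range of `f`, then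
the functionals `y` with `y ⊗ v ∈ A` vanish on `ker f`: otherwise `f + y ⊗ v` has larger rank. -/
theorem rankOneFunctionals_le_dualAnnihilator {A : Submodule F (E →ₗ[F] V)} {f : E →ₗ[F] V}
    (hA : ∀ g ∈ A, Module.finrank F (LinearMap.range (f + g)) ≤
      Module.finrank F (LinearMap.range f)) {v : V} (hv : v ∉ LinearMap.range f) :
    rankOneFunctionals A v ≤ (LinearMap.ker f).dualAnnihilator := by
  intro y hy
  rw [Submodule.mem_dualAnnihilator]
  intro x hx
  by_contra hyx
  rw [LinearMap.mem_ker] at hx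
  have hvmem : v ∈ LinearMap.range (f + y.smulRight v) :=
    ⟨(y x)⁻¹ • x, by simp [hx, hyx]⟩
  have hle : LinearMap.range f ≤ LinearMap.range (f + y.smulRight v) := by
    rintro _ ⟨z, rfl⟩
    have : f z = (f + y.smulRight v) z - y z • v := by simp
    rw [this]
    exact Submodule.sub_mem _ ⟨z, rfl⟩ (Submodule.smul_mem _ _ hvmem)
  have hlt : LinearMap.range f < LinearMap.range (f + y.smulRight v) :=
    lt_of_le_of_ne hle fun h => hv (h ▸ hvmem)
  exact absurd (Submodule.finrank_lt_finrank_of_lt hlt) (not_lt.2 (hA _ hy))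

variable [FiniteDimensional F V]

theorem finrank_quotient_span_singleton {v : V} (hv : v ≠ 0) :
    Module.finrank F (V ⧸ Submodule.span F {v}) + 1 = Module.finrank F V := by
  rw [← finrank_span_singleton (K := F) hv, Submodule.finrank_quotient_add_finrank]

/-- If the rank does not exceed `r` on the line `g + F (y ⊗ v)`, then restricting `g` to `ker y`
and reducing it modulo `v` leaves a map of rank less than `r`. -/
theorem finrank_range_compress_lt {g : E →ₗ[F] V} {y : Module.Dual F E} {v : V} {r : ℕ}
    (hy : y ≠ 0) (hv : v ≠ 0)
    (hg : ∀ c : F, Module.finrank F (LinearMap.range (g + c • y.smulRight v)) ≤ r) :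
    Module.finrank F (LinearMap.range (compress y v g)) < r := by
  obtain ⟨e, he⟩ := LinearMap.surjective hy 1
  set T := (LinearMap.ker y).map g with hT
  have hrange : LinearMap.range (compress y v g) = T.map (Submodule.mkQ (Submodule.span F {v})) := by
    change LinearMap.range ((Submodule.mkQ _ ∘ₗ g) ∘ₗ (LinearMap.ker y).subtype) = _
    rw [LinearMap.range_comp, Submodule.range_subtype, Submodule.map_comp]
  have hsum := T.finrank_map_add_finrank_inf_ker (Submodule.mkQ (Submodule.span F {v}))
  have hTle : ∀ c : F, T ≤ LinearMap.range (g + c • y.smulRight v) := by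
    rintro c _ ⟨x, hx, rfl⟩
    exact ⟨x, by simp [LinearMap.mem_ker.1 hx]⟩
  rw [hrange]
  by_contra! hcon
  have hTeq : ∀ c : F, T = LinearMap.range (g + c • y.smulRight v) := fun c =>
    Submodule.eq_of_le_of_finrank_le (hTle c) ((hg c).trans (by omega))
  -- the values of `g` and `g + y ⊗ v` at `e` differ by `v`
  have hvT : v ∈ T := by
    have h0 : g e ∈ T := by rw [hTeq 0]; exact ⟨e, by simp⟩
    have h1 : g e + v ∈ T := by rw [hTeq 1]; exact ⟨e, by simp [he]⟩
    simpa using T.sub_mem h1 h0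
  have hpos : 0 < Module.finrank F
      (T ⊓ LinearMap.ker (Submodule.mkQ (Submodule.span F {v})) : Submodule F V) := by
    refine Module.finrank_pos_iff_exists_ne_zero.2
      ⟨⟨v, hvT, by simp⟩, fun h => hv ?_⟩
    exact congrArg Subtype.val h
  have hle := (Submodule.finrank_mono (hTle 0)).trans (hg 0)
  omega

theorem finrank_inf_ker_compress_le (A : Submodule F (E →ₗ[F] V)) {y : Module.Dual F E} {v : V}
    (hy : y ≠ 0) (hv : v ≠ 0) :
    Module.finrank F (A ⊓ LinearMap.ker (compress y v) : Submodule F (E →ₗ[F] V)) + 1 ≤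
      Module.finrank F (rankOneFunctionals A v) + Module.finrank F V := by
  obtain ⟨e, he⟩ := LinearMap.surjective hy 1
  -- an element of the kernel is determined, up to maps with values in `F v`, by its value at `e`
  set ev : (E →ₗ[F] V) →ₗ[F] V ⧸ Submodule.span F {v} :=
    Submodule.mkQ _ ∘ₗ LinearMap.applyₗ e with hev
  have hsum := (A ⊓ LinearMap.ker (compress y v)).finrank_map_add_finrank_inf_ker ev
  have h1 := ((A ⊓ LinearMap.ker (compress y v)).map ev).finrank_le
  have h2 := finrank_quotient_span_singleton (F := F) hv
  have h3 : A ⊓ LinearMap.ker (compress y v) ⊓ LinearMap.ker ev ≤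
      (rankOneFunctionals A v).map (LinearMap.smulRightₗ.flip v) := by
    rintro g ⟨⟨hg, hg'⟩, hge⟩
    refine inf_ker_reduceMod_le A hv ⟨hg, ?_⟩
    rw [SetLike.mem_coe, LinearMap.mem_ker]
    ext x
    have hx : x - y x • e ∈ LinearMap.ker y := by simp [he]
    have h4 := LinearMap.congr_fun (LinearMap.mem_ker.1 hg') ⟨_, hx⟩
    have h5 : Submodule.mkQ (Submodule.span F {v}) (g e) = 0 := hge
    change Submodule.mkQ (Submodule.span F {v}) (g (x - y x • e)) = 0 at h4
    rw [map_sub, map_sub, map_smul, map_smul, h5, smul_zero, sub_zero] at h4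
    exact h4
  have h4 : _ ≤ Module.finrank F (rankOneFunctionals A v) :=
    (Submodule.finrank_mono h3).trans (Submodule.finrank_map_le _ _)
  omega

theorem finrank_map_reduceMod (A : Submodule F (E →ₗ[F] V)) {v : V} (hv : v ≠ 0)
    (hR : rankOneFunctionals A v = ⊥) :
    Module.finrank F (A.map (reduceMod E v)) = Module.finrank F A := by
  have h := A.finrank_map_add_finrank_inf_ker (reduceMod E v)
  have h2 := inf_ker_reduceMod_le A hv
  rw [hR, Submodule.map_bot, le_bot_iff] at h2
  rw [h2, finrank_bot] at h
  exact h

end RankOne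

/-- An affine space `f + A` of linear maps of rank at most `r` has dimension at most
`r * dim E`. This is the bound of Flanders, over an arbitrary field. -/
theorem finrank_le_mul_of_finrank_range_le {F : Type*} [Field F] (k : ℕ) :
    ∀ {E V : Type*} [AddCommGroup E] [Module F E] [FiniteDimensional F E]
      [AddCommGroup V] [Module F V] [FiniteDimensional F V],
      Module.finrank F V = k → k ≤ Module.finrank F E →
      ∀ (A : Submodule F (E →ₗ[F] V)) (f : E →ₗ[F] V) (r : ℕ),
        (∀ g ∈ A, Module.finrank F (LinearMap.range (f + g)) ≤ r) →
        Module.finrank F A ≤ Module.finrank F E * r := by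
  induction k with
  | zero =>
    intro E V _ _ _ _ _ _ hV hE A f r hA
    have := A.finrank_le
    rw [Module.finrank_linearMap, hV] at this
    omega
  | succ k ih =>
    intro E V _ _ _ _ _ _ hV hE A f r hA
    -- translate `f` to an element of maximal rank
    obtain ⟨f, r, hA, hfr, hr⟩ : ∃ (f' : E →ₗ[F] V) (s : ℕ),
        (∀ g ∈ A, Module.finrank F (LinearMap.range (f' + g)) ≤ s) ∧
        Module.finrank F (LinearMap.range f') = s ∧ s ≤ r := by
      have hex : ∃ s, s ≤ r ∧ ∀ g ∈ A, Module.finrank F (LinearMap.range (f + g)) ≤ s :=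
        ⟨r, le_rfl, hA⟩
      classical
      have hmax := Nat.find_spec hex
      obtain ⟨g, hg, hg'⟩ : ∃ g ∈ A,
          Module.finrank F (LinearMap.range (f + g)) = Nat.find hex := by
        by_contra! hne
        rcases Nat.eq_zero_or_pos (Nat.find hex) with h0 | h0
        · have h1 := hmax.2 0 A.zero_mem
          have h2 := hne 0 A.zero_mem
          omega
        · refine Nat.find_min hex (Nat.sub_lt h0 one_pos) ⟨by omega, fun g hg => ?_⟩
          have h1 := hmax.2 g hg
          have h2 := hne g hg
          omega
      refine ⟨f + g, Nat.find hex, fun g' hg'' => ?_, hg', hmax.1⟩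
      rw [add_assoc]
      exact hmax.2 _ (A.add_mem hg hg'')
    refine le_trans ?_ (Nat.mul_le_mul_left _ hr)
    rcases eq_or_ne (LinearMap.range f) ⊤ with htop | htop
    · have := A.finrank_le
      rw [Module.finrank_linearMap] at this
      rw [htop, finrank_top] at hfr
      rwa [hfr] at this
    obtain ⟨v, hv⟩ : ∃ v, v ∉ LinearMap.range f := by
      by_contra! h
      exact htop (eq_top_iff.2 fun x _ => h x)
    have hv0 : v ≠ 0 := fun h => hv (h ▸ Submodule.zero_mem _)
    have hVv := finrank_quotient_span_singleton (F := F) hv0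
    -- without rank one maps `y ⊗ v`, reduction modulo `v` loses nothing; with one, compressing with
    -- respect to `y` and `v` lowers the rank
    rcases eq_or_ne (rankOneFunctionals A v) ⊥ with hR | hR
    · rw [← finrank_map_reduceMod A hv0 hR]
      refine ih (by omega) (by omega) _ (reduceMod E v f) r ?_
      rintro _ ⟨g, hg, rfl⟩
      rw [← map_add]
      exact (finrank_range_reduceMod_le v _).trans (hA g hg)
    · obtain ⟨y, hy, hy0⟩ := Submodule.exists_mem_ne_zero_of_ne_bot hR
      have hEy := finrank_ker_dual hy0
      have hRle := Submodule.finrank_mono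
        (rankOneFunctionals_le_dualAnnihilator (fun g hg => (hA g hg).trans hfr.ge) hv)
      rw [finrank_dualAnnihilator_ker, hfr] at hRle
      have hRpos : 0 < Module.finrank F (rankOneFunctionals A v) := by
        have : rankOneFunctionals A v ≠ ⊥ := hR
        exact Nat.pos_of_ne_zero fun h => this (Submodule.finrank_eq_zero.1 h)
      have h1 := finrank_inf_ker_compress_le A hy0 hv0
      have h2 := ih (E := LinearMap.ker y) (V := V ⧸ Submodule.span F {v}) (by omega) (by omega)
        (A.map (compress y v)) (compress y v f) (r - 1) (by
          rintro _ ⟨g, hg, rfl⟩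
          rw [← map_add]
          have := finrank_range_compress_lt (g := f + g) (r := r) hy0 hv0 fun c => by
            rw [add_assoc]
            exact hA _ (A.add_mem hg (A.smul_mem c hy))
          omega)
      have h3 := A.finrank_map_add_finrank_inf_ker (compress y v)
      obtain ⟨s, rfl⟩ : ∃ s, r = s + 1 := ⟨r - 1, by omega⟩
      rw [← hEy] at hE ⊢
      rw [Nat.add_sub_cancel] at h2
      -- `dim A ≤ (dim E - 1) * (r - 1) + r + (dim V - 1) ≤ dim E * r`
      nlinarith

/-! ### Spaces of linear maps of bounded rank with the largest dimension -/

section MaxDimension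

variable {F E V U : Type*} [Field F] [AddCommGroup E] [Module F E] [FiniteDimensional F E]
  [AddCommGroup V] [Module F V] [AddCommGroup U] [Module F U]

/-- A linear map that vanishes on `K` lies in a subspace `N` as soon as `N` contains the rank one
maps `x ↦ y x • a`, where `y` vanishes on `K` and `a` is a value of the map. -/
theorem mem_of_forall_smulRight_mem {N : Submodule F (E →ₗ[F] V)} {K : Submodule F E}
    {f : E →ₗ[F] V} (hf : K ≤ LinearMap.ker f)
    (hN : ∀ y : Module.Dual F E, K ≤ LinearMap.ker y → ∀ a ∈ LinearMap.range f,
      y.smulRight a ∈ N) : f ∈ N := by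
  set b := Module.finBasis F (E ⧸ K)
  have hsum : f = ∑ i, (b.coord i ∘ₗ K.mkQ).smulRight (K.liftQ f hf (b i)) := by
    ext x
    have h := congrArg (K.liftQ f hf) (b.sum_repr (K.mkQ x))
    rw [map_sum] at h
    simpa [LinearMap.sum_apply] using h.symm
  rw [hsum]
  refine N.sum_mem fun i _ => hN _ (fun x hx => ?_) _ ?_
  · simp [(Submodule.Quotient.mk_eq_zero K).2 hx]
  · obtain ⟨x, hx⟩ := K.mkQ_surjective (b i)
    exact ⟨x, by rw [← hx]; simp⟩

theorem exists_le_ker_range_eq [FiniteDimensional F U] (N : Submodule F E) (T : Submodule F U)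
    (h : Module.finrank F T + Module.finrank F N ≤ Module.finrank F E) :
    ∃ k : E →ₗ[F] U, N ≤ LinearMap.ker k ∧ LinearMap.range k = T := by
  have hq := N.finrank_quotient_add_finrank
  obtain ⟨i, hi⟩ := (finrank_le_iff_exists_linearMap (R := F) (M := T) (M' := E ⧸ N)).1 (by omega)
  obtain ⟨p, hp⟩ := i.exists_leftInverse_of_injective (LinearMap.ker_eq_bot.2 hi)
  have hps : Function.Surjective p := fun t => ⟨i t, LinearMap.congr_fun hp t⟩
  refine ⟨T.subtype ∘ₗ p ∘ₗ N.mkQ, fun x hx => ?_, ?_⟩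
  · simp [(Submodule.Quotient.mk_eq_zero N).2 hx]
  · rw [LinearMap.range_comp, LinearMap.range_eq_top.2
      (show Function.Surjective (p ∘ₗ N.mkQ) from hps.comp N.mkQ_surjective),
      Submodule.map_top, Submodule.range_subtype]

/-- In every direction of rank one there is a line consisting of surjective maps, and these can be
chosen to vanish on a given subspace `N` of `ker y`, if there is enough room. -/
theorem exists_forall_surjective_add_smul [FiniteDimensional F U] {N : Submodule F E}
    {y : Module.Dual F E} (hN : N ≤ LinearMap.ker y) (hy : y ≠ 0) (a : U)
    (h : 2 ≤ Module.finrank F U ∧ Module.finrank F U + Module.finrank F N ≤ Module.finrank F E ∨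
      Module.finrank F U + Module.finrank F N < Module.finrank F E) :
    ∃ M : E →ₗ[F] U, N ≤ LinearMap.ker M ∧
      ∀ c : F, Function.Surjective (M + c • y.smulRight a) := by
  obtain ⟨e, he⟩ := LinearMap.surjective hy 1
  obtain ⟨T, u, ha, hT, hdim⟩ : ∃ (T : Submodule F U) (u : U), a ∈ T ∧
      (∀ x : U, ∃ d : F, x - d • u ∈ T) ∧
      Module.finrank F T + Module.finrank F N + 1 ≤ Module.finrank F E := by
    rcases h with ⟨h2, h⟩ | h
    · have hlt : Submodule.span F {a} < ⊤ := by
        refine lt_top_iff_ne_top.2 fun htop => ?_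
        have h1 := finrank_span_le_card (R := F) ({a} : Set U)
        rw [htop, finrank_top] at h1
        simp at h1
        omega
      obtain ⟨z, hz, hza⟩ := Submodule.exists_le_ker_of_lt_top _ hlt
      obtain ⟨u, hu⟩ := LinearMap.surjective hz 1
      refine ⟨LinearMap.ker z, u, hza (Submodule.mem_span_singleton_self a),
        fun x => ⟨z x, by simp [hu]⟩, ?_⟩
      have := finrank_ker_dual hz
      omega
    · exact ⟨⊤, 0, trivial, fun x => ⟨0, trivial⟩, by rw [finrank_top]; omega⟩
  obtain ⟨k, hk, hkT⟩ := exists_le_ker_range_eq (N ⊔ Submodule.span F {e}) T (by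
    have h1 := Submodule.finrank_add_le_finrank_add_finrank N (Submodule.span F {e})
    have h2 := finrank_span_le_card (R := F) ({e} : Set E)
    simp at h2
    omega)
  have hke : k e = 0 := hk (Submodule.mem_sup_right (Submodule.mem_span_singleton_self e))
  refine ⟨k + y.smulRight u, fun x hx => ?_, fun c x => ?_⟩
  · have h1 : k x = 0 := hk (Submodule.mem_sup_left hx)
    have h2 : y x = 0 := hN hx
    simp [h1, h2]
  · obtain ⟨d, hd⟩ := hT x
    have hmem : x - d • u - (d * c) • a ∈ LinearMap.range k := by
      rw [hkT]
      exact T.sub_mem hd (T.smul_mem _ ha)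
    obtain ⟨z, hz⟩ := hmem
    refine ⟨z - y z • e + d • e, ?_⟩
    simp only [LinearMap.add_apply, LinearMap.smul_apply, LinearMap.smulRight_apply, map_add,
      map_sub, map_smul, hz, hke, he, zero_add]
    module

/-- A linear operation `s` on maps `E → U`, where `dim U < dim E`, is the composition with a map
`U → V`, if it does not shrink the kernels of surjective maps. -/
theorem exists_eq_comp_of_ker_le [FiniteDimensional F U]
    (s : (E →ₗ[F] U) →ₗ[F] (E →ₗ[F] V)) (hdim : Module.finrank F U < Module.finrank F E)
    (hs : ∀ g : E →ₗ[F] U, Function.Surjective g → LinearMap.ker g ≤ LinearMap.ker (s g)) :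
    ∃ σ : U →ₗ[F] V, ∀ g, s g = σ ∘ₗ g := by
  -- `y ⊗ a` is a difference of two surjective maps that vanish at a given `x ∈ ker y`
  have key : ∀ (a : U) (y : Module.Dual F E) (x : E), y x = 0 → s (y.smulRight a) x = 0 := by
    intro a y x hx
    rcases eq_or_ne y 0 with rfl | hy
    · simp
    rcases eq_or_ne a 0 with rfl | ha
    · simp
    have hpos : 0 < Module.finrank F U := Module.finrank_pos_iff_exists_ne_zero.2 ⟨a, ha⟩
    rcases Nat.lt_or_ge (Module.finrank F U) 2 with h2 | h2
    · refine hs _ (fun u => ?_) (by simp [hx])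
      obtain ⟨c, rfl⟩ := exists_smul_eq_of_finrank_eq_one
        (show Module.finrank F U = 1 by omega) ha u
      obtain ⟨e, he⟩ := LinearMap.surjective hy c
      exact ⟨e, by simp [he]⟩
    · have h1 := finrank_span_le_card (R := F) ({x} : Set E)
      simp at h1
      obtain ⟨M, hM, hM'⟩ := exists_forall_surjective_add_smul (N := Submodule.span F {x})
        (y := y) (by simpa using hx) hy a (Or.inl ⟨h2, by omega⟩)
      have hMx : M x = 0 := hM (Submodule.mem_span_singleton_self x)
      have h3 : s M x = 0 := hs M (by simpa using hM' 0) hMx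
      have h4 : s (M + y.smulRight a) x = 0 :=
        hs _ (by simpa using hM' 1) (by simp [hMx, hx])
      simpa [h3] using h4
  set b := Module.finBasis F E
  let i₀ : Fin (Module.finrank F E) := ⟨0, by omega⟩
  refine ⟨LinearMap.applyₗ (b i₀) ∘ₗ s ∘ₗ LinearMap.smulRightₗ (b.coord i₀), fun g => ?_⟩
  have hoff : ∀ i j, i ≠ j → ∀ a, s ((b.coord i).smulRight a) (b j) = 0 := fun i j hij a =>
    key a _ _ (by simp [hij.symm])
  have hdiag : ∀ j a, s ((b.coord j).smulRight a) (b j) =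
      s ((b.coord i₀).smulRight a) (b i₀) := by
    intro j a
    rcases eq_or_ne j i₀ with rfl | hj
    · rfl
    have h := key a (b.coord j + b.coord i₀) (b j - b i₀)
      (by simp [hj, hj.symm])
    have h' : (b.coord j + b.coord i₀).smulRight a =
        (b.coord j).smulRight a + (b.coord i₀).smulRight a := by ext; simp [add_smul]
    rw [h', map_add, map_sub, LinearMap.add_apply, LinearMap.add_apply, hoff _ _ hj.symm,
      hoff _ _ hj, add_zero, zero_add] at h
    exact sub_eq_zero.1 h
  have hg : g = ∑ i, (b.coord i).smulRight (g (b i)) := by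
    refine b.ext fun j => ?_
    simp [LinearMap.sum_apply, Finsupp.single_apply]
  refine b.ext fun j => ?_
  conv_lhs => rw [hg]
  rw [map_sum, LinearMap.sum_apply, Finset.sum_eq_single j (fun i _ hij => hoff i j hij _)
    (by simp), hdiag]
  rfl

variable [FiniteDimensional F V]

/-- If all maps in `P` have rank at most `w`, and `P` is mapped isomorphically onto the space of
all maps into a `w`-dimensional subspace of `V / F v`, then `P` is the space of all maps into a
`w`-dimensional subspace of `V`. -/
theorem exists_mem_iff_range_le_of_reduceMod {P : Submodule F (E →ₗ[F] V)} {w : ℕ}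
    (hP : ∀ g ∈ P, Module.finrank F (LinearMap.range g) ≤ w) (hw : w < Module.finrank F E)
    {v : V} (hv : v ≠ 0) (hR : rankOneFunctionals P v = ⊥)
    {U : Submodule F (V ⧸ Submodule.span F {v})} (hU : Module.finrank F U = w)
    (hPU : ∀ f, f ∈ P.map (reduceMod E v) ↔ LinearMap.range f ≤ U) :
    ∃ U' : Submodule F V, Module.finrank F U' = w ∧ ∀ f, f ∈ P ↔ LinearMap.range f ≤ U' := by
  have hinj : Function.Injective ((reduceMod E v).domRestrict P) := by
    rw [← LinearMap.ker_eq_bot, eq_bot_iff]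
    rintro ⟨g, hg⟩ hg'
    have h := inf_ker_reduceMod_le P hv ⟨hg, hg'⟩
    rw [hR, Submodule.map_bot, Submodule.mem_bot] at h
    exact Subtype.ext h
  -- the inverse `s` of the reduction
  let e := LinearEquiv.ofInjective _ hinj
  let c : (E →ₗ[F] U) →ₗ[F] LinearMap.range ((reduceMod E v).domRestrict P) :=
    LinearMap.codRestrict _ (LinearMap.compRight F U.subtype) fun g => by
      rw [LinearMap.range_domRestrict, hPU]
      rintro _ ⟨x, rfl⟩
      exact (g x).2
  let s : (E →ₗ[F] U) →ₗ[F] (E →ₗ[F] V) := P.subtype ∘ₗ e.symm.toLinearMap ∘ₗ c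
  have hsP : ∀ g, s g ∈ P := fun g => (e.symm (c g)).2
  have hsr : ∀ g, reduceMod E v (s g) = U.subtype ∘ₗ g := fun g =>
    congrArg Subtype.val (e.apply_symm_apply (c g))
  have hs : ∀ f ∈ P, ∃ g, s g = f := by
    intro f hf
    have hfU := (hPU _).1 ⟨f, hf, rfl⟩
    refine ⟨LinearMap.codRestrict U (reduceMod E v f) fun x => hfU ⟨x, rfl⟩, ?_⟩
    have : (⟨_, hsP (LinearMap.codRestrict U (reduceMod E v f) fun x => hfU ⟨x, rfl⟩)⟩ : P) =
        ⟨f, hf⟩ := hinj (by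
      change reduceMod E v (s _) = reduceMod E v f
      rw [hsr]
      rfl)
    exact congrArg Subtype.val this
  obtain ⟨σ, hσ⟩ := exists_eq_comp_of_ker_le s (hU ▸ hw) fun g hg => by
    have hle : LinearMap.ker (s g) ≤ LinearMap.ker g := by
      intro x hx
      have h := LinearMap.congr_fun (hsr g) x
      rw [reduceMod_apply, LinearMap.mem_ker.1 hx, map_zero] at h
      exact Subtype.ext h.symm
    have h1 := (s g).finrank_range_add_finrank_ker
    have h2 := g.finrank_range_add_finrank_ker
    have h3 := hP _ (hsP g)
    rw [LinearMap.range_eq_top.2 hg, finrank_top, hU] at h2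
    exact (Submodule.eq_of_le_of_finrank_le hle (by omega)).ge
  have hσinj : Function.Injective σ := by
    obtain ⟨x, hx⟩ := Module.finrank_pos_iff_exists_ne_zero.1 (show 0 < Module.finrank F E by omega)
    obtain ⟨y, hy⟩ := Module.Projective.exists_dual_eq_one F hx
    rw [← LinearMap.ker_eq_bot, eq_bot_iff]
    intro a ha
    have h := LinearMap.congr_fun (hsr (y.smulRight a)) x
    rw [hσ, reduceMod_apply] at h
    simp only [LinearMap.comp_apply, LinearMap.smulRight_apply, hy, one_smul,
      LinearMap.mem_ker.1 ha, map_zero] at h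
    exact Subtype.ext h.symm
  refine ⟨LinearMap.range σ, by rw [LinearMap.finrank_range_of_inj hσinj, hU], fun f => ⟨?_, ?_⟩⟩
  · intro hf
    obtain ⟨g, rfl⟩ := hs f hf
    rw [hσ]
    exact LinearMap.range_comp_le_range _ _
  · intro hf
    have : f = σ ∘ₗ ((LinearEquiv.ofInjective σ hσinj).symm.toLinearMap ∘ₗ
        LinearMap.codRestrict (LinearMap.range σ) f fun x => hf ⟨x, rfl⟩) := by
      ext x
      exact (congrArg Subtype.val ((LinearEquiv.ofInjective σ hσinj).apply_symm_apply
        ⟨f x, hf ⟨x, rfl⟩⟩)).symm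
    rw [this, ← hσ]
    exact hsP _

end MaxDimension

/-- A space `P` of linear maps `E → V` of rank at most `w`, with `dim V ≤ dim E` and
`dim P = w * dim E`, consists of all maps with values in a `w`-dimensional subspace or, possibly
if `dim V = dim E`, of all maps that vanish on a subspace of codimension `w`. -/
theorem exists_mem_iff_range_le_or_le_ker {F : Type*} [Field F] (k : ℕ) :
    ∀ {E V : Type*} [AddCommGroup E] [Module F E] [FiniteDimensional F E]
      [AddCommGroup V] [Module F V] [FiniteDimensional F V],
      Module.finrank F V = k → k ≤ Module.finrank F E →
      ∀ (P : Submodule F (E →ₗ[F] V)) (w : ℕ), w ≤ k →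
        (∀ g ∈ P, Module.finrank F (LinearMap.range g) ≤ w) →
        Module.finrank F P = Module.finrank F E * w →
        (∃ U : Submodule F V, Module.finrank F U = w ∧ ∀ f, f ∈ P ↔ LinearMap.range f ≤ U) ∨
        (w < k ∧ k = Module.finrank F E ∧ ∃ K : Submodule F E,
          Module.finrank F K + w = Module.finrank F E ∧ ∀ f, f ∈ P ↔ K ≤ LinearMap.ker f) := by
  induction k with
  | zero =>
    intro E V _ _ _ _ _ _ hV hE P w hw hP hdim
    refine Or.inl ⟨⊥, by rw [finrank_bot]; omega, fun f => ?_⟩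
    have : Subsingleton V := Module.finrank_zero_iff.1 hV
    rw [Subsingleton.elim f 0]
    simp
  | succ k ih =>
    intro E V _ _ _ _ _ _ hV hE P w hw hP hdim
    rcases hw.eq_or_lt with rfl | hwk
    · have : P = ⊤ := Submodule.eq_top_of_finrank_eq (by
        rw [hdim, Module.finrank_linearMap, hV])
      exact Or.inl ⟨⊤, by rw [finrank_top, hV], by simp [this]⟩
    obtain ⟨f, hf, hfw⟩ : ∃ f ∈ P, Module.finrank F (LinearMap.range f) = w := by
      rcases Nat.eq_zero_or_pos w with rfl | hwpos
      · exact ⟨0, P.zero_mem, by simp⟩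
      by_contra! hne
      have := finrank_le_mul_of_finrank_range_le (k + 1) hV hE P 0 (w - 1) fun g hg => by
        have h1 := hP g hg
        have h2 := hne g hg
        rw [zero_add]
        omega
      rw [hdim] at this
      have := Nat.le_of_mul_le_mul_left this (by omega)
      omega
    by_cases hR : ∃ v, v ∉ LinearMap.range f ∧ rankOneFunctionals P v = ⊥
    · obtain ⟨v, hv, hR⟩ := hR
      have hv0 : v ≠ 0 := fun h => hv (h ▸ Submodule.zero_mem _)
      have hVv := finrank_quotient_span_singleton (F := F) hv0
      left
      rcases ih (V := V ⧸ Submodule.span F {v}) (by omega) (by omega) (P.map (reduceMod E v)) w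
        (by omega) (by
          rintro _ ⟨g, hg, rfl⟩
          exact (finrank_range_reduceMod_le v g).trans (hP g hg))
        (by rw [finrank_map_reduceMod P hv0 hR, hdim]) with
        ⟨U, hU, hPU⟩ | ⟨-, h, -⟩
      · exact exists_mem_iff_range_le_of_reduceMod hP (by omega) hv0 hR hU hPU
      · omega
    · push Not at hR
      right
      have hlt : LinearMap.range f ≠ ⊤ := fun h => by
        rw [h, finrank_top] at hfw
        omega
      obtain ⟨v₀, hv₀⟩ : ∃ v, v ∉ LinearMap.range f := by
        by_contra! h
        exact hlt (eq_top_iff.2 fun x _ => h x)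
      have hall : ∀ v, v ∉ LinearMap.range f → k + 1 = Module.finrank F E ∧
          rankOneFunctionals P v = (LinearMap.ker f).dualAnnihilator := by
        intro v hv
        have hv0 : v ≠ 0 := fun h => hv (h ▸ Submodule.zero_mem _)
        have hVv := finrank_quotient_span_singleton (F := F) hv0
        obtain ⟨y, hy, hy0⟩ := Submodule.exists_mem_ne_zero_of_ne_bot (hR v hv)
        have hEy := finrank_ker_dual hy0
        have hRle := rankOneFunctionals_le_dualAnnihilator
          (fun g hg => (hP _ (P.add_mem hf hg)).trans hfw.ge) hv
        have hRle' := Submodule.finrank_mono hRle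
        have hann := finrank_dualAnnihilator_ker f
        have hlow := finrank_range_compress_lt (g := f) (r := w) hy0 hv0 fun c =>
          hP _ (P.add_mem hf (P.smul_mem c hy))
        have h1 := finrank_inf_ker_compress_le P hy0 hv0
        have h2 := finrank_le_mul_of_finrank_range_le k (E := LinearMap.ker y)
          (V := V ⧸ Submodule.span F {v}) (by omega) (by omega)
          (P.map (compress y v)) 0 (w - 1) (by
            rintro _ ⟨g, hg, rfl⟩
            rw [zero_add]
            have := finrank_range_compress_lt (g := g) (r := w) hy0 hv0 fun c =>
              hP _ (P.add_mem hg (P.smul_mem c hy))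
            omega)
        have h3 := P.finrank_map_add_finrank_inf_ker (compress y v)
        obtain ⟨s, rfl⟩ : ∃ s, w = s + 1 := ⟨w - 1, by omega⟩
        rw [← hEy] at hE hdim ⊢
        rw [Nat.add_sub_cancel] at h2
        rw [hfw] at hann
        rw [hV] at h1
        -- the estimates for `dim P` leave room for no more than equality everywhere
        have h4 : Module.finrank F (LinearMap.ker y) + (s + 1) ≤
            Module.finrank F (rankOneFunctionals P v) + k := by nlinarith
        exact ⟨by omega, Submodule.eq_of_le_of_finrank_le hRle (by omega)⟩
      have hkE := (hall v₀ hv₀).1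
      have hsm : ∀ (y : Module.Dual F E), LinearMap.ker f ≤ LinearMap.ker y →
          ∀ a : V, y.smulRight a ∈ P := by
        intro y hy a
        have hout : ∀ v, v ∉ LinearMap.range f → y.smulRight v ∈ P := fun v hv => by
          rw [← mem_rankOneFunctionals, (hall v hv).2, Submodule.mem_dualAnnihilator]
          exact fun x hx => hy hx
        by_cases ha : a ∈ LinearMap.range f
        · have hav : v₀ + a ∉ LinearMap.range f := fun h =>
            hv₀ (by simpa using Submodule.sub_mem _ h ha)
          have : y.smulRight a = y.smulRight (v₀ + a) - y.smulRight v₀ := by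
            ext; simp [smul_add]
          rw [this]
          exact P.sub_mem (hout _ hav) (hout _ hv₀)
        · exact hout a ha
      have hker := f.finrank_range_add_finrank_ker
      have hsub : LinearMap.range (LinearMap.lcomp F V (LinearMap.ker f).mkQ) ≤ P := by
        rintro _ ⟨g, rfl⟩
        refine mem_of_forall_smulRight_mem (K := LinearMap.ker f) (fun x hx => ?_)
          fun y hy a _ => hsm y hy a
        rw [LinearMap.mem_ker, LinearMap.lcomp_apply, Submodule.mkQ_apply,
          (Submodule.Quotient.mk_eq_zero _).2 hx, map_zero]
      have hinj : Function.Injective (LinearMap.lcomp F V (LinearMap.ker f).mkQ) := fun g g' h =>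
        LinearMap.ext fun x => by
          obtain ⟨x, rfl⟩ := (LinearMap.ker f).mkQ_surjective x
          exact LinearMap.congr_fun h x
      have heq := Submodule.eq_of_le_of_finrank_le hsub (by
        have hq := (LinearMap.ker f).finrank_quotient_add_finrank
        have hq' : Module.finrank F (E ⧸ LinearMap.ker f) = w := by omega
        rw [LinearMap.finrank_range_of_inj hinj, Module.finrank_linearMap, hdim, hV, hkE, hq',
          mul_comm])
      refine ⟨hwk, hkE, LinearMap.ker f, by omega, fun g => ⟨fun hg => ?_, fun hg => ?_⟩⟩
      · rw [← heq] at hg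
        obtain ⟨g, rfl⟩ := hg
        intro x hx
        rw [LinearMap.mem_ker, LinearMap.lcomp_apply, Submodule.mkQ_apply,
          (Submodule.Quotient.mk_eq_zero _).2 hx, map_zero]
      · exact mem_of_forall_smulRight_mem hg fun y hy a _ => hsm y hy a

/-- A space `P` of maps of rank at most `w` with the largest dimension `w * dim E`, where
`dim E ≥ 2`, is spanned by the directions of the affine lines in `P` on which the rank is
constantly `w`. -/
theorem le_of_forall_line_direction_mem {F E V : Type*} [Field F] [AddCommGroup E] [Module F E]
    [FiniteDimensional F E] [AddCommGroup V] [Module F V] [FiniteDimensional F V]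
    (hVE : Module.finrank F V ≤ Module.finrank F E) (hE : 2 ≤ Module.finrank F E)
    {P N : Submodule F (E →ₗ[F] V)} {w : ℕ} (hw : w ≤ Module.finrank F V)
    (hP : ∀ g ∈ P, Module.finrank F (LinearMap.range g) ≤ w)
    (hdim : Module.finrank F P = Module.finrank F E * w)
    (hN : ∀ g ∈ P, (∃ f ∈ P, ∀ c : F, Module.finrank F (LinearMap.range (f + c • g)) = w) →
      g ∈ N) : P ≤ N := by
  intro f hf
  rcases exists_mem_iff_range_le_or_le_ker _ rfl hVE P w hw hP hdim with
    ⟨U, hU, hPU⟩ | ⟨hwlt, hVE', K, hK, hPK⟩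
  · refine mem_of_forall_smulRight_mem (K := ⊥) bot_le fun y _ a ha => ?_
    rcases eq_or_ne y 0 with rfl | hy
    · simp
    have haU : a ∈ U := (hPU f).1 hf ha
    obtain ⟨M, -, hM⟩ := exists_forall_surjective_add_smul (N := ⊥) (U := U) bot_le hy ⟨a, haU⟩
      (by rw [finrank_bot, hU]; omega)
    have hcomp : ∀ c : F, U.subtype ∘ₗ M + c • y.smulRight a =
        U.subtype ∘ₗ (M + c • y.smulRight ⟨a, haU⟩) := fun c => by ext; simp
    refine hN _ ((hPU _).2 ?_) ⟨U.subtype ∘ₗ M, (hPU _).2 ?_, fun c => ?_⟩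
    · rintro _ ⟨x, rfl⟩
      exact U.smul_mem _ haU
    · rintro _ ⟨x, rfl⟩
      exact (M x).2
    · rw [hcomp, LinearMap.range_comp, LinearMap.range_eq_top.2 (hM c), Submodule.map_top,
        Submodule.range_subtype, hU]
  · refine mem_of_forall_smulRight_mem ((hPK f).1 hf) fun y hy a _ => ?_
    rcases eq_or_ne a 0 with rfl | ha
    · simp
    -- a map with kernel `K` that stays injective on `E / K` when reduced modulo `a`
    have h1 := K.finrank_quotient_add_finrank
    have h2 := finrank_quotient_span_singleton (F := F) ha
    obtain ⟨i, hi⟩ := (finrank_le_iff_exists_linearMap (R := F) (M := E ⧸ K)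
      (M' := V ⧸ Submodule.span F {a})).1 (by omega)
    obtain ⟨j, hj⟩ := (Submodule.mkQ (Submodule.span F {a})).exists_rightInverse_of_surjective
      (Submodule.range_mkQ _)
    have hker : ∀ c : F, LinearMap.ker (j ∘ₗ i ∘ₗ K.mkQ + c • y.smulRight a) = K := by
      refine fun c => le_antisymm (fun x hx => ?_) (fun x hx => ?_)
      · have h3 := congrArg (Submodule.mkQ (Submodule.span F {a})) (LinearMap.mem_ker.1 hx)
        have h4 := LinearMap.congr_fun hj (i (K.mkQ x))
        have h5 : Submodule.mkQ (Submodule.span F {a}) a = 0 := by simp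
        simp only [LinearMap.comp_apply, LinearMap.id_apply] at h4
        simp only [LinearMap.add_apply, LinearMap.comp_apply, LinearMap.smul_apply,
          LinearMap.smulRight_apply, map_add, map_smul, h4, h5, smul_zero, add_zero, map_zero] at h3
        rw [← map_zero i] at h3
        exact (Submodule.Quotient.mk_eq_zero K).1 (hi h3)
      · have hyx : y x = 0 := hy hx
        simp [(Submodule.Quotient.mk_eq_zero K).2 hx, hyx]
    refine hN _ ((hPK _).2 fun x hx => ?_)
      ⟨j ∘ₗ i ∘ₗ K.mkQ, (hPK _).2 (by simpa using (hker 0).ge), fun c => ?_⟩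
    · have hyx : y x = 0 := hy hx
      simp [hyx]
    · have h3 := (j ∘ₗ i ∘ₗ K.mkQ + c • y.smulRight a).finrank_range_add_finrank_ker
      rw [hker] at h3
      omega

/-! ### Spaces of matrices of bounded rank -/

section Matrices

variable {F : Type*} [Field F]

theorem Matrix.finrank_range_toLin' {a b : ℕ} (X : Matrix (Fin a) (Fin b) F) :
    Module.finrank F (LinearMap.range (Matrix.toLin' X)) = X.rank := rfl

/-- Every affine space `X₀ + A` of `a × b` matrices, where `a ≤ b`, contains a matrix of rank at
least `dim A / b`. -/
theorem exists_finrank_le_mul_rank {a b : ℕ} (hab : a ≤ b)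
    (A : Submodule F (Matrix (Fin a) (Fin b) F)) (X₀ : Matrix (Fin a) (Fin b) F) :
    ∃ X ∈ A, Module.finrank F A ≤ b * (X₀ + X).rank := by
  by_contra! h
  have hpos : 0 < Module.finrank F A := (Nat.zero_le _).trans_lt (h 0 A.zero_mem)
  have hb : 0 < b := by
    have := A.finrank_le
    rw [Module.finrank_matrix] at this
    simp only [Module.finrank_self, Fintype.card_fin, mul_one] at this
    exact pos_of_mul_pos_right (hpos.trans_le this) (Nat.zero_le _)
  have hmap := LinearEquiv.finrank_map_eq
    (Matrix.toLin' : Matrix (Fin a) (Fin b) F ≃ₗ[F] _) A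
  have hle := finrank_le_mul_of_finrank_range_le a (E := Fin b → F) (V := Fin a → F) (by simp)
    (by simpa using hab) (A.map (Matrix.toLin' : Matrix (Fin a) (Fin b) F ≃ₗ[F] _).toLinearMap)
    (Matrix.toLin' X₀) ((Module.finrank F A - 1) / b) (by
      rintro _ ⟨X, hX, rfl⟩
      have h1 := h X hX
      change Module.finrank F (LinearMap.range (Matrix.toLin' X₀ + Matrix.toLin' X)) ≤ _
      rw [← map_add, Matrix.finrank_range_toLin', Nat.le_div_iff_mul_le hb, mul_comm]
      omega)
  rw [hmap, Module.finrank_fin_fun] at hle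
  have := Nat.mul_div_le (Module.finrank F A - 1) b
  omega

/-- A space `P` of `a × b` matrices of rank at most `w` with the largest dimension `b * w`, where
`a ≤ b` and `b ≥ 2`, is spanned by the directions of the affine lines in `P` on which the rank is
constantly `w`. -/
theorem le_of_forall_matrix_line_direction_mem {a b : ℕ} (hab : a ≤ b) (hb : 2 ≤ b)
    {P N : Submodule F (Matrix (Fin a) (Fin b) F)} {w : ℕ} (hw : w ≤ a)
    (hP : ∀ X ∈ P, X.rank ≤ w) (hdim : Module.finrank F P = b * w)
    (hN : ∀ Y ∈ P, (∃ X ∈ P, ∀ c : F, (X + c • Y).rank = w) → Y ∈ N) : P ≤ N := by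
  let e : Matrix (Fin a) (Fin b) F ≃ₗ[F] _ := Matrix.toLin'
  have hmap := LinearEquiv.finrank_map_eq e P
  have hle : P.map e.toLinearMap ≤ N.map e.toLinearMap := by
    refine le_of_forall_line_direction_mem (w := w) (by simpa using hab) (by simpa using hb)
      (by simpa using hw) ?_ (by rw [hmap, hdim, Module.finrank_fin_fun]) ?_
    · rintro _ ⟨X, hX, rfl⟩
      exact hP X hX
    · rintro _ ⟨Y, hY, rfl⟩ ⟨_, ⟨X, hX, rfl⟩, hc⟩
      refine ⟨Y, hN Y hY ⟨X, hX, fun c => ?_⟩, rfl⟩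
      rw [← hc c, ← Matrix.finrank_range_toLin']
      change Module.finrank F (LinearMap.range (e (X + c • Y))) =
        Module.finrank F (LinearMap.range (e X + c • e Y))
      rw [map_add, map_smul]
  exact (Submodule.map_le_map_iff_of_injective e.injective _ _).1 hle

theorem exists_rank_eq {a b : ℕ} (hab : a ≤ b) (hb : 0 < b) :
    ∃ X : Matrix (Fin a) (Fin b) F, X.rank = a := by
  obtain ⟨X, -, hX⟩ := exists_finrank_le_mul_rank hab (⊤ : Submodule F (Matrix (Fin a) (Fin b) F)) 0
  rw [finrank_top, Module.finrank_matrix, zero_add] at hX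
  simp only [Module.finrank_self, Fintype.card_fin, mul_one] at hX
  rw [mul_comm] at hX
  exact ⟨X, le_antisymm X.rank_le_height (Nat.le_of_mul_le_mul_left hX hb)⟩

end Matrices

/-! ### The maximum of `∑ m_i u_i` -/

section BoundValues

variable {ι : Type*} [Fintype ι] {n m u : ι → ℕ}

theorem mul_le_threshold_add {c a b x : ℕ} (h : x ≤ b) : a * x ≤ c * x + (a - c) * b := by
  calc a * x ≤ (c + (a - c)) * x := Nat.mul_le_mul_right _ (by omega)
    _ = c * x + (a - c) * x := add_mul _ _ _
    _ ≤ _ := Nat.add_le_add_left (Nat.mul_le_mul_left _ h) _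

theorem sum_mul_le_threshold {r : ℕ} (c : ℕ) (hu : ∀ i, u i ≤ n i) (hr : ∑ i, u i ≤ r) :
    ∑ i, m i * u i ≤ c * r + ∑ i, (m i - c) * n i := by
  calc ∑ i, m i * u i ≤ ∑ i, (c * u i + (m i - c) * n i) :=
        Finset.sum_le_sum fun i _ => mul_le_threshold_add (hu i)
    _ = c * ∑ i, u i + ∑ i, (m i - c) * n i := by rw [Finset.sum_add_distrib, Finset.mul_sum]
    _ ≤ _ := Nat.add_le_add_right (Nat.mul_le_mul_left _ hr) _

theorem sum_mul_eq_threshold {c : ℕ} (hlarge : ∀ i, c < m i → u i = n i)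
    (hsmall : ∀ i, m i < c → u i = 0) :
    ∑ i, m i * u i = c * ∑ i, u i + ∑ i, (m i - c) * n i := by
  rw [Finset.mul_sum, ← Finset.sum_add_distrib]
  refine Finset.sum_congr rfl fun i _ => ?_
  rcases lt_trichotomy c (m i) with h | h | h
  · rw [hlarge i h, ← add_mul, Nat.add_sub_cancel' h.le]
  · simp [h]
  · simp [hsmall i h, Nat.sub_eq_zero_of_le h.le]

/-- Complementary slackness for the upper bound `sum_mul_le_threshold`. -/
theorem slackness_of_threshold_le_sum_mul {c r : ℕ} (hu : ∀ i, u i ≤ n i)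
    (hr : ∑ i, u i ≤ r) (h : c * r + ∑ i, (m i - c) * n i ≤ ∑ i, m i * u i) (i : ι) :
    (c < m i → u i = n i) ∧ (m i < c → u i = 0) := by
  have hle : ∀ i ∈ Finset.univ, m i * u i ≤ c * u i + (m i - c) * n i := fun i _ =>
    mul_le_threshold_add (hu i)
  have heq : ∑ i, m i * u i = ∑ i, (c * u i + (m i - c) * n i) := by
    refine le_antisymm (Finset.sum_le_sum hle) (le_trans ?_ h)
    rw [Finset.sum_add_distrib, ← Finset.mul_sum]
    exact Nat.add_le_add_right (Nat.mul_le_mul_left _ hr) _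
  have hi := (Finset.sum_eq_sum_iff_of_le hle).1 heq i (Finset.mem_univ i)
  constructor
  · intro hc
    obtain ⟨d, hd⟩ := Nat.exists_eq_add_of_lt hc
    have h1 : m i - c = d + 1 := by omega
    rw [h1, show m i = c + (d + 1) by omega, add_mul] at hi
    exact Nat.eq_of_mul_eq_mul_left (Nat.succ_pos d) (Nat.add_left_cancel hi)
  · intro hc
    rw [Nat.sub_eq_zero_of_le hc.le, zero_mul, add_zero] at hi
    by_contra h0
    exact absurd (Nat.eq_of_mul_eq_mul_right (Nat.pos_of_ne_zero h0) hi) hc.ne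

theorem isGreatest_boundValues {c r : ℕ} (hu : ∀ i, u i ≤ n i) (hr : ∑ i, u i = r)
    (hlarge : ∀ i, c < m i → u i = n i) (hsmall : ∀ i, m i < c → u i = 0) :
    IsGreatest (boundValues n m r) (∑ i, m i * u i) := by
  refine ⟨⟨u, hu, hr, rfl⟩, ?_⟩
  rintro _ ⟨u', hu', hr', rfl⟩
  rw [sum_mul_eq_threshold hlarge hsmall, hr]
  exact sum_mul_le_threshold c hu' hr'.le

theorem isGreatest_boundValues_const {b r : ℕ} (hu : ∀ i, u i ≤ n i) (hr : ∑ i, u i = r) :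
    IsGreatest (boundValues n (fun _ => b) r) (b * r) := by
  have h := isGreatest_boundValues (m := fun _ => b) (c := b) hu hr (by simp) (by simp)
  rwa [← Finset.mul_sum, hr] at h

theorem eq_mul_of_mem_boundValues_const {b r k : ℕ} (h : k ∈ boundValues n (fun _ => b) r) :
    k = b * r := by
  obtain ⟨u, -, hr, rfl⟩ := h
  rw [← Finset.mul_sum, hr]

end BoundValues

/-! ### Large linear anticodes in the sum-rank metric -/

section SumRank

variable {F : Type*} [Field F] {ι : Type*} [Fintype ι] {n m : ι → ℕ}

theorem SumRankSpace.eq_sum_single [DecidableEq ι] (X : SumRankSpace F n m) :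
    X = ∑ i, LinearMap.single F (fun i => Matrix (Fin (n i)) (Fin (m i)) F) i (X i) := by
  simp only [LinearMap.single_apply]
  exact (Finset.univ_sum_single X).symm

theorem finrank_submodule_pi {M : ι → Type*} [∀ i, AddCommGroup (M i)] [∀ i, Module F (M i)]
    [∀ i, FiniteDimensional F (M i)] (B : (i : ι) → Submodule F (M i)) :
    Module.finrank F (Submodule.pi Set.univ B) = ∑ i, Module.finrank F (B i) := by
  let e : Submodule.pi Set.univ B ≃ₗ[F] ((i : ι) → B i) :=
    { toFun := fun X i => ⟨X.1 i, X.2 i (Set.mem_univ i)⟩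
      invFun := fun X => ⟨fun i => X i, fun i _ => (X i).2⟩
      map_add' := fun _ _ => rfl
      map_smul' := fun _ _ => rfl
      left_inv := fun _ => rfl
      right_inv := fun _ => rfl }
  rw [e.finrank_eq, Module.finrank_pi_fintype]

/-- An affine space `X₀ + A`, whose direction `A` is determined by the blocks in `s`, contains an
element that is large in these blocks. -/
theorem exists_finrank_le_sum_mul_rank (hnm : ∀ i, n i ≤ m i) (s : Finset ι) :
    ∀ (A : Submodule F (SumRankSpace F n m)) (X₀ : SumRankSpace F n m),
      (∀ X ∈ A, (∀ i ∈ s, X i = 0) → X = 0) →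
      ∃ X ∈ A, Module.finrank F A ≤ ∑ i ∈ s, m i * ((X₀ + X) i).rank := by
  classical
  induction s using Finset.induction_on with
  | empty =>
    intro A X₀ hA
    have : A = ⊥ := (Submodule.eq_bot_iff A).2 fun X hX => hA X hX (by simp)
    exact ⟨0, A.zero_mem, by simp [this]⟩
  | insert i s hi ih =>
    intro A X₀ hA
    set π : SumRankSpace F n m →ₗ[F] Matrix (Fin (n i)) (Fin (m i)) F := LinearMap.proj i
    obtain ⟨_, ⟨X₁, hX₁, rfl⟩, hdim₁⟩ := exists_finrank_le_mul_rank (hnm i) (A.map π) (X₀ i)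
    obtain ⟨X₂, hX₂, hdim₂⟩ := ih (A ⊓ LinearMap.ker π) (X₀ + X₁) fun X hX hXs =>
      hA X hX.1 fun k hk => by
        rcases Finset.mem_insert.1 hk with rfl | hk
        · exact hX.2
        · exact hXs k hk
    have hX₂i : X₂ i = 0 := hX₂.2
    refine ⟨X₁ + X₂, A.add_mem hX₁ hX₂.1, ?_⟩
    rw [Finset.sum_insert hi, ← add_assoc, ← A.finrank_map_add_finrank_inf_ker π]
    refine Nat.add_le_add ?_ hdim₂
    rwa [Pi.add_apply, Pi.add_apply, hX₂i, add_zero]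

theorem sum_mul_rank_le {c r : ℕ} {X : SumRankSpace F n m} (hX : srk X ≤ r) :
    ∑ i, m i * (X i).rank ≤ c * r + ∑ i, (m i - c) * n i :=
  sum_mul_le_threshold c (fun i => (X i).rank_le_height) hX

variable {A : Submodule F (SumRankSpace F n m)} {c r : ℕ}

/-- Every element of `A` can be changed outside block `i` to make it large there. -/
theorem exists_apply_eq_and_add_finrank_le (hnm : ∀ i, n i ≤ m i) (i : ι)
    {X : SumRankSpace F n m} (hX : X ∈ A) :
    ∃ X' ∈ A, X' i = X i ∧ m i * (X i).rank +
      Module.finrank F (A ⊓ LinearMap.ker (LinearMap.proj i) :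
        Submodule F (SumRankSpace F n m)) ≤ ∑ k, m k * (X' k).rank := by
  classical
  obtain ⟨Z, hZ, hdim⟩ := exists_finrank_le_sum_mul_rank hnm (Finset.univ.erase i)
    (A ⊓ LinearMap.ker (LinearMap.proj i)) X fun Y hY h0 => funext fun k => by
      rcases eq_or_ne k i with rfl | hk
      · exact hY.2
      · exact h0 k (by simp [hk])
  have hZi : Z i = 0 := hZ.2
  refine ⟨X + Z, A.add_mem hX hZ.1, by simp [hZi], ?_⟩
  rw [← Finset.add_sum_erase _ _ (Finset.mem_univ i)]
  refine Nat.add_le_add ?_ hdim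
  simp [hZi]

/-- If the rank is constant in block `i` along the line `X + F Y` in `A`, and block `i` of `Y` does
not itself belong to `A`, then there is one more dimension available outside block `i`. -/
theorem exists_mul_add_finrank_lt [DecidableEq ι] (hnm : ∀ i, n i ≤ m i) (i : ι)
    {X Y : SumRankSpace F n m} (hX : X ∈ A) (hY : Y ∈ A) {p : ℕ}
    (hp : ∀ c : F, (X i + c • Y i).rank = p)
    (hYi : LinearMap.single F (fun i => Matrix (Fin (n i)) (Fin (m i)) F) i (Y i) ∉ A) :
    ∃ X' ∈ A, m i * p + Module.finrank F (A ⊓ LinearMap.ker (LinearMap.proj i) :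
      Submodule F (SumRankSpace F n m)) < ∑ k, m k * (X' k).rank := by
  set A' : Submodule F (SumRankSpace F n m) := A ⊓ LinearMap.ker (LinearMap.proj i)
  have hYA' : Y ∉ A' := fun h => hYi (by
    have : Y i = 0 := h.2
    simp [this])
  have hlt : A' < A' ⊔ Submodule.span F {Y} := lt_of_le_of_ne le_sup_left fun h =>
    hYA' (h ▸ Submodule.mem_sup_right (Submodule.mem_span_singleton_self Y))
  have hcomp : ∀ Z ∈ A' ⊔ Submodule.span F {Y}, Z ∈ A ∧ ∃ c : F, Z i = c • Y i ∧
      (c = 0 → Z i = 0) := by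
    intro Z hZ
    obtain ⟨Z', hZ', W, hW, rfl⟩ := Submodule.mem_sup.1 hZ
    obtain ⟨c, rfl⟩ := Submodule.mem_span_singleton.1 hW
    have hZi : Z' i = 0 := hZ'.2
    refine ⟨A.add_mem hZ'.1 (A.smul_mem c hY), c, by simp [hZi], ?_⟩
    rintro rfl
    simp [hZi]
  obtain ⟨Z, hZ, hdim⟩ := exists_finrank_le_sum_mul_rank hnm (Finset.univ.erase i)
    (A' ⊔ Submodule.span F {Y}) X fun Z hZ h0 => by
      have h0' : ∀ k, k ≠ i → Z k = 0 := fun k hk => h0 k (by simp [hk])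
      obtain ⟨hZA, c, hc, hc0⟩ := hcomp Z hZ
      rcases eq_or_ne c 0 with h | h
      · funext k
        rcases eq_or_ne k i with rfl | hk
        · exact hc0 h
        · exact h0' k hk
      · exfalso
        apply hYi
        have : LinearMap.single F (fun i => Matrix (Fin (n i)) (Fin (m i)) F) i (Y i) =
            c⁻¹ • Z := by
          funext k
          rcases eq_or_ne k i with rfl | hk
          · simp [hc, smul_smul, h]
          · simp [h0' k hk, hk]
        rw [this]
        exact A.smul_mem _ hZA
  obtain ⟨hZA, c, hc, -⟩ := hcomp Z hZ
  refine ⟨X + Z, A.add_mem hX hZA, ?_⟩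
  rw [← Finset.add_sum_erase _ _ (Finset.mem_univ i), Pi.add_apply X Z i, hc, hp]
  exact Nat.add_lt_add_left ((Submodule.finrank_lt_finrank_of_lt hlt).trans_le hdim) _

/-- The projection of a linear anticode of the largest dimension to a block is a linear anticode of
the largest dimension in the rank metric. -/
theorem exists_finrank_map_proj_eq (hnm : ∀ i, n i ≤ m i) (hmpos : ∀ i, 0 < m i)
    (hA : ∀ X ∈ A, srk X ≤ r)
    (hdim : Module.finrank F A = c * r + ∑ i, (m i - c) * n i) (i : ι) :
    ∃ p, p ≤ n i ∧ (∀ X ∈ A, (X i).rank ≤ p) ∧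
      Module.finrank F (A.map (LinearMap.proj i)) = m i * p ∧
      (c < m i → p = n i) ∧ (m i < c → p = 0) := by
  have hsum := A.finrank_map_add_finrank_inf_ker (LinearMap.proj i)
  have hle : ∀ X ∈ A, m i * (X i).rank ≤ Module.finrank F (A.map (LinearMap.proj i)) := by
    intro X hX
    obtain ⟨X', hX', -, h1⟩ := exists_apply_eq_and_add_finrank_le hnm i hX
    have h2 := sum_mul_rank_le (c := c) (hA X' hX')
    omega
  obtain ⟨_, ⟨X, hX, rfl⟩, hge⟩ :=
    exists_finrank_le_mul_rank (hnm i) (A.map (LinearMap.proj i)) 0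
  rw [zero_add, LinearMap.proj_apply] at hge
  have hXdim := le_antisymm hge (hle X hX)
  obtain ⟨X', hX', hX'i, h1⟩ := exists_apply_eq_and_add_finrank_le hnm i hX
  have hslack := slackness_of_threshold_le_sum_mul (c := c) (m := m)
    (fun k => (X' k).rank_le_height) (hA X' hX') (by omega) i
  rw [hX'i] at hslack
  refine ⟨(X i).rank, (X i).rank_le_height, fun Y hY => ?_, hXdim, hslack⟩
  exact Nat.le_of_mul_le_mul_left ((hle Y hY).trans hge) (hmpos i)

/-- A linear anticode of the largest dimension splits off every block with more than one column. -/
theorem single_apply_mem [DecidableEq ι] (hnm : ∀ i, n i ≤ m i) (hmpos : ∀ i, 0 < m i)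
    (hA : ∀ X ∈ A, srk X ≤ r)
    (hdim : Module.finrank F A = c * r + ∑ i, (m i - c) * n i) {i : ι} (hi : 2 ≤ m i)
    {X : SumRankSpace F n m} (hX : X ∈ A) :
    LinearMap.single F (fun i => Matrix (Fin (n i)) (Fin (m i)) F) i (X i) ∈ A := by
  obtain ⟨p, hpn, hp, hpdim, -⟩ := exists_finrank_map_proj_eq hnm hmpos hA hdim i
  have hsum := A.finrank_map_add_finrank_inf_ker (LinearMap.proj i)
  have hle : A.map (LinearMap.proj i) ≤
      A.comap (LinearMap.single F (fun i => Matrix (Fin (n i)) (Fin (m i)) F) i) := by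
    refine le_of_forall_matrix_line_direction_mem (hnm i) hi hpn ?_ hpdim ?_
    · rintro _ ⟨Y, hY, rfl⟩
      exact hp Y hY
    · rintro _ ⟨Y, hY, rfl⟩ ⟨_, ⟨Z, hZ, rfl⟩, hc⟩
      by_contra hcon
      obtain ⟨X', hX', hlt⟩ := exists_mul_add_finrank_lt hnm i hZ hY hc hcon
      have := sum_mul_rank_le (c := c) (hA X' hX')
      omega
  exact hle ⟨X, hX, rfl⟩

/-- If all projections of vectors of `A` to single blocks belong to `A`, then `A` is the direct sum
of its projections. -/
theorem eq_pi_map_proj [DecidableEq ι]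
    (h : ∀ i, ∀ X ∈ A, LinearMap.single F (fun i => Matrix (Fin (n i)) (Fin (m i)) F) i (X i) ∈ A) :
    A = Submodule.pi Set.univ fun i => A.map (LinearMap.proj i) := by
  refine le_antisymm (fun X hX i _ => ⟨X, hX, rfl⟩) fun X hX => ?_
  rw [SumRankSpace.eq_sum_single X]
  refine A.sum_mem fun i _ => ?_
  obtain ⟨Y, hY, hYX⟩ := hX i (Set.mem_univ i)
  rw [← hYX]
  exact h i Y hY

theorem srk_le_of_mem_optimalSumRankAnticodes (hA : A ∈ optimalSumRankAnticodes F n m r)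
    {X : SumRankSpace F n m} (hX : X ∈ A) : srk X ≤ r := by
  simpa using hA.1.2 X hX 0 A.zero_mem

theorem isSumRankAnticode_of_forall_srk_le (hA : ∀ X ∈ A, srk X ≤ r) :
    IsSumRankAnticode r (A : Set (SumRankSpace F n m)) :=
  ⟨⟨0, A.zero_mem⟩, fun _ hX _ hY => hA _ (A.sub_mem hX hY)⟩

/-- The direct sum of optimal anticodes in the rank metric, whose radii maximize `∑ m_i ρ_i`, is
optimal in the sum-rank metric. -/
theorem pi_mem_optimalSumRankAnticodes {B : (i : ι) → Submodule F (Matrix (Fin (n i)) (Fin (m i)) F)}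
    {ρ : ι → ℕ} (hρ : ∀ i, ρ i ≤ n i) (hB : ∀ i, ∀ X ∈ B i, X.rank ≤ ρ i)
    (hdim : ∀ i, Module.finrank F (B i) = m i * ρ i) (hr : ∑ i, ρ i = r)
    (hlarge : ∀ i, c < m i → ρ i = n i) (hsmall : ∀ i, m i < c → ρ i = 0) :
    Submodule.pi Set.univ B ∈ optimalSumRankAnticodes F n m r := by
  refine ⟨isSumRankAnticode_of_forall_srk_le fun X hX => ?_, ?_⟩
  · rw [← hr]
    exact Finset.sum_le_sum fun i _ => hB i _ (hX i (Set.mem_univ i))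
  · rw [finrank_submodule_pi, Finset.sum_congr rfl fun i _ => hdim i]
    exact isGreatest_boundValues hρ hr hlarge hsmall

theorem isOptimalRankAnticode_iff {a b ρ : ℕ} (hρ : ρ ≤ a)
    {B : Submodule F (Matrix (Fin a) (Fin b) F)} :
    IsOptimalRankAnticode ρ B ↔ (∀ X ∈ B, X.rank ≤ ρ) ∧ Module.finrank F B = b * ρ := by
  constructor
  · rintro ⟨h1, h2⟩
    exact ⟨fun X hX => by simpa using h1 X hX 0 B.zero_mem, eq_mul_of_mem_boundValues_const h2.1⟩
  · rintro ⟨h1, h2⟩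
    refine ⟨fun X hX Y hY => h1 _ (B.sub_mem hX hY), ?_⟩
    rw [h2]
    exact isGreatest_boundValues_const (u := fun _ => ρ) (fun _ => hρ) (by simp)

end SumRank

/-! ### Sums over initial segments of `Fin t` -/

section InitialSegments

variable {t : ℕ}

theorem sum_Iio_add_le {n : Fin t → ℕ} {j k : Fin t} (h : j < k) :
    ∑ i ∈ Finset.Iio j, n i + n j ≤ ∑ i ∈ Finset.Iio k, n i := by
  rw [add_comm, ← Finset.sum_insert (by simp)]
  refine Finset.sum_le_sum_of_subset fun i hi => ?_
  simp only [Finset.mem_insert, Finset.mem_Iio] at hi ⊢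
  omega

theorem sum_Iio_add_sum_Ico {n : Fin t → ℕ} {l j : Fin t} (h : l ≤ j) :
    ∑ i ∈ Finset.Iio l, n i + ∑ i ∈ Finset.Ico l j, n i = ∑ i ∈ Finset.Iio j, n i := by
  rw [← Finset.sum_union (Finset.disjoint_left.2 fun i hi hi' => by simp at hi hi'; omega)]
  congr 1
  ext i
  simp
  omega

theorem sum_eq_sum_Iio_add_sum_Icc {u : Fin t → ℕ} {l l' : Fin t}
    (hu : ∀ i, l' < i → u i = 0) :
    ∑ i, u i = ∑ i ∈ Finset.Iio l, u i + ∑ i ∈ Finset.Icc l l', u i := by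
  rw [← Finset.sum_union (Finset.disjoint_left.2 fun i hi hi' => by simp at hi hi'; omega)]
  refine (Finset.sum_subset (Finset.subset_univ _) fun i _ hi => hu i ?_).symm
  simp at hi
  omega

theorem sum_eq_sum_Iio_add_sum_subtype {u : Fin t → ℕ} (l : Fin t) :
    ∑ i, u i = ∑ i ∈ Finset.Iio l, u i + ∑ i : {i : Fin t // l ≤ i}, u i := by
  rw [← Finset.sum_subtype (Finset.Ici l) (by simp) u,
    ← Finset.sum_union (Finset.disjoint_left.2 fun i hi hi' => by simp at hi hi'; omega)]
  congr 1
  ext i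
  simp
  omega

/-- Division with remainder of `r` with respect to the partial sums of `n`. -/
theorem existsUnique_partial_sum {n : Fin t → ℕ} {r : ℕ} (hr : r < ∑ i, n i) :
    ∃! p : Fin t × ℕ, p.2 < n p.1 ∧ r = ∑ i ∈ Finset.Iio p.1, n i + p.2 := by
  have ht : 0 < t := by
    rcases Nat.eq_zero_or_pos t with rfl | h
    · simp at hr
    · exact h
  obtain ⟨j, hj, hmax⟩ := Finset.exists_max_image
    (Finset.univ.filter fun j : Fin t => ∑ i ∈ Finset.Iio j, n i ≤ r) id
    ⟨⟨0, ht⟩, by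
      have : Finset.Iio (⟨0, ht⟩ : Fin t) = ∅ := by ext i; simp [Fin.lt_def]
      simp [this]⟩
  simp only [Finset.mem_filter, Finset.mem_univ, true_and, id] at hj hmax
  have hlt : r < ∑ i ∈ Finset.Iio j, n i + n j := by
    by_contra! hle
    have hins : ∑ i ∈ Finset.Iio j, n i + n j = ∑ i ∈ insert j (Finset.Iio j), n i := by
      rw [Finset.sum_insert (by simp), add_comm]
    rw [hins] at hle
    rcases Nat.lt_or_ge (j + 1) t with h | h
    · have heq : insert j (Finset.Iio j) = Finset.Iio (⟨j + 1, h⟩ : Fin t) := by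
        ext i
        simp [Fin.lt_def]
      have h1 := hmax ⟨j + 1, h⟩ (heq ▸ hle)
      simp [Fin.le_def] at h1
    · have heq : insert j (Finset.Iio j) = Finset.univ := by
        ext i
        simp
        omega
      rw [heq] at hle
      omega
  refine ⟨(j, r - ∑ i ∈ Finset.Iio j, n i), ⟨by simp only; omega, by simp only; omega⟩, ?_⟩
  rintro ⟨k, δ⟩ ⟨h1, h2⟩
  simp only at h1 h2
  rcases lt_trichotomy j k with h | rfl | h
  · have := sum_Iio_add_le (n := n) h
    omega
  · exact Prod.ext rfl (by simp only; omega)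
  · have := sum_Iio_add_le (n := n) h
    omega

end InitialSegments

/-! ### Blocks of size `1 × 1` -/

section Hamming

variable {F : Type*} [Field F] {t : ℕ} {n m : Fin t → ℕ}

/-- The vector of the upper left entries of the blocks at the positions `i ≥ l`. -/
def cornerEntries (F : Type*) [Field F] {t : ℕ} {n m : Fin t → ℕ} (hn : ∀ i, 0 < n i)
    (hmpos : ∀ i, 0 < m i) (l : Fin t) :
    SumRankSpace F n m →ₗ[F] ({i : Fin t // l ≤ i} → F) where
  toFun X k := X k ⟨0, hn k⟩ ⟨0, hmpos k⟩
  map_add' _ _ := rfl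
  map_smul' _ _ := rfl

theorem cornerEntries_apply (hn : ∀ i, 0 < n i) (hmpos : ∀ i, 0 < m i) (l : Fin t)
    (X : SumRankSpace F n m) (k : {i : Fin t // l ≤ i}) :
    cornerEntries F hn hmpos l X k = X k ⟨0, hn k⟩ ⟨0, hmpos k⟩ := rfl

variable {l : Fin t} (hn : ∀ i, 0 < n i) (hmpos : ∀ i, 0 < m i)

include hn hmpos in
theorem apply_eq_cornerEntries (h1 : ∀ i, l ≤ i → n i = 1 ∧ m i = 1) (X : SumRankSpace F n m)
    (k : {i : Fin t // l ≤ i}) (a : Fin (n k)) (b : Fin (m k)) :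
    X k a b = cornerEntries F hn hmpos l X k := by
  have h := h1 k k.2
  have ha : a = ⟨0, hn k⟩ := Fin.ext (by have := a.2; simp only; omega)
  have hb : b = ⟨0, hmpos k⟩ := Fin.ext (by have := b.2; simp only; omega)
  rw [ha, hb, cornerEntries_apply]

theorem mem_fullBlocksOplusHamming (h1 : ∀ i, l ≤ i → n i = 1 ∧ m i = 1)
    {Ah : Submodule F ({i : Fin t // l ≤ i} → F)} {X : SumRankSpace F n m} :
    X ∈ fullBlocksOplusHamming n m l Ah ↔ cornerEntries F hn hmpos l X ∈ Ah := by
  constructor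
  · rintro ⟨v, hv, hX⟩
    have : cornerEntries F hn hmpos l X = v := funext fun k => hX k _ _
    rwa [this]
  · exact fun h => ⟨_, h, fun k a b => apply_eq_cornerEntries hn hmpos h1 X k a b⟩

theorem rank_eq_zero_iff_cornerEntries (h1 : ∀ i, l ≤ i → n i = 1 ∧ m i = 1)
    (X : SumRankSpace F n m) (k : {i : Fin t // l ≤ i}) :
    (X k).rank = 0 ↔ cornerEntries F hn hmpos l X k = 0 := by
  constructor
  · intro h
    have h0 : X k = 0 := (Matrix.toLin' : _ ≃ₗ[F] _).map_eq_zero_iff.1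
      (LinearMap.range_eq_bot.1 (Submodule.finrank_eq_zero.1 h))
    rw [cornerEntries_apply, h0]
    rfl
  · intro h
    have h0 : X k = 0 := by
      ext a b
      rw [apply_eq_cornerEntries hn hmpos h1 X k a b, h]
      rfl
    rw [h0, Matrix.rank_zero]

open Classical in
/-- On blocks of size `1 × 1`, the sum-rank is the Hamming weight. -/
theorem sum_rank_eq_hammingNorm (h1 : ∀ i, l ≤ i → n i = 1 ∧ m i = 1)
    (X : SumRankSpace F n m) :
    ∑ k : {i : Fin t // l ≤ i}, (X k).rank = hammingNorm (cornerEntries F hn hmpos l X) := by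
  rw [hammingNorm, Finset.card_filter]
  refine Finset.sum_congr rfl fun k _ => ?_
  have h0 := rank_eq_zero_iff_cornerEntries hn hmpos h1 X k
  have hle : (X k).rank ≤ 1 := (X k).rank_le_height.trans (h1 k k.2).1.le
  split_ifs with h
  · have : (X k).rank ≠ 0 := fun h' => h (h0.1 h')
    omega
  · exact h0.2 (not_not.1 h)

include hn hmpos in
theorem finrank_fullBlocksOplusHamming (h1 : ∀ i, l ≤ i → n i = 1 ∧ m i = 1)
    (Ah : Submodule F ({i : Fin t // l ≤ i} → F)) :
    Module.finrank F (fullBlocksOplusHamming n m l Ah) =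
      ∑ i ∈ Finset.Iio l, m i * n i + Module.finrank F Ah := by
  have h := (fullBlocksOplusHamming n m l Ah).finrank_map_add_finrank_inf_ker
    (cornerEntries F hn hmpos l)
  have hmap : (fullBlocksOplusHamming n m l Ah).map (cornerEntries F hn hmpos l) = Ah := by
    ext v
    constructor
    · rintro ⟨X, hX, rfl⟩
      exact (mem_fullBlocksOplusHamming hn hmpos h1).1 hX
    · intro hv
      let X : SumRankSpace F n m := fun i _ _ => if h : l ≤ i then v ⟨i, h⟩ else 0
      have hXv : cornerEntries F hn hmpos l X = v := funext fun k => by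
        rw [cornerEntries_apply]
        exact dif_pos k.2
      exact ⟨X, (mem_fullBlocksOplusHamming hn hmpos h1).2 (hXv ▸ hv), hXv⟩
  have hker : fullBlocksOplusHamming n m l Ah ⊓ LinearMap.ker (cornerEntries F hn hmpos l) =
      Submodule.pi Set.univ fun i => if l ≤ i then
        (⊥ : Submodule F (Matrix (Fin (n i)) (Fin (m i)) F)) else ⊤ := by
    ext X
    simp only [Submodule.mem_inf, LinearMap.mem_ker, Submodule.mem_pi, Set.mem_univ,
      true_implies]
    constructor
    · rintro ⟨-, hX⟩ i
      split_ifs with hi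
      · rw [Submodule.mem_bot]
        ext a b
        rw [apply_eq_cornerEntries hn hmpos h1 X ⟨i, hi⟩ a b, hX]
        rfl
      · trivial
    · intro hX
      have h0 : cornerEntries F hn hmpos l X = 0 := funext fun k => by
        have := hX k
        rw [if_pos k.2, Submodule.mem_bot] at this
        rw [cornerEntries_apply, this]
        rfl
      exact ⟨(mem_fullBlocksOplusHamming hn hmpos h1).2 (h0 ▸ Ah.zero_mem), h0⟩
  rw [hmap, hker, finrank_submodule_pi, sum_eq_sum_Iio_add_sum_subtype l] at h
  have hlow : ∑ i ∈ Finset.Iio l, Module.finrank F (if l ≤ i then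
      (⊥ : Submodule F (Matrix (Fin (n i)) (Fin (m i)) F)) else ⊤ : Submodule F _) =
      ∑ i ∈ Finset.Iio l, m i * n i := by
    refine Finset.sum_congr rfl fun i hi => ?_
    rw [if_neg (not_le.2 (Finset.mem_Iio.1 hi)), finrank_top, Module.finrank_matrix]
    simp [mul_comm]
  have hhigh : ∑ k : {i : Fin t // l ≤ i}, Module.finrank F (if l ≤ k.1 then
      (⊥ : Submodule F (Matrix (Fin (n k)) (Fin (m k)) F)) else ⊤ : Submodule F _) = 0 := by
    refine Finset.sum_eq_zero fun k _ => ?_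
    rw [if_pos k.2, finrank_bot]
  rw [hlow, hhigh] at h
  omega

theorem threshold_one_eq (h1 : ∀ i, l ≤ i → n i = 1 ∧ m i = 1) (hmpos : ∀ i, 0 < m i) (s : ℕ) :
    1 * (∑ i ∈ Finset.Iio l, n i + s) + ∑ i, (m i - 1) * n i =
      ∑ i ∈ Finset.Iio l, m i * n i + s := by
  have h0 : ∑ k : {i : Fin t // l ≤ i}, (m k - 1) * n k = 0 :=
    Finset.sum_eq_zero fun k _ => by simp [(h1 k k.2).2]
  have hlow : ∑ i ∈ Finset.Iio l, n i + ∑ i ∈ Finset.Iio l, (m i - 1) * n i =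
      ∑ i ∈ Finset.Iio l, m i * n i := by
    rw [← Finset.sum_add_distrib]
    refine Finset.sum_congr rfl fun i _ => ?_
    obtain ⟨d, hd⟩ : ∃ d, m i = d + 1 := ⟨m i - 1, by have := hmpos i; omega⟩
    rw [hd, Nat.add_sub_cancel]
    ring
  rw [sum_eq_sum_Iio_add_sum_subtype l, h0]
  omega

/-- If `m_i = 1` exactly for `i ≥ l`, then a linear anticode of the largest dimension contains all
blocks `i < l`, and is determined by a linear anticode in the Hamming metric. -/
theorem exists_eq_fullBlocksOplusHamming (hn : ∀ i, 0 < n i) (hnm : ∀ i, n i ≤ m i)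
    (h1 : ∀ i, l ≤ i → n i = 1 ∧ m i = 1) (h2 : ∀ i, i < l → 1 < m i)
    {A : Submodule F (SumRankSpace F n m)} {s : ℕ}
    (hA : ∀ X ∈ A, srk X ≤ ∑ i ∈ Finset.Iio l, n i + s)
    (hdim : Module.finrank F A =
      1 * (∑ i ∈ Finset.Iio l, n i + s) + ∑ i, (m i - 1) * n i) :
    ∃ Ah : Submodule F ({i : Fin t // l ≤ i} → F),
      IsOptimalHammingAnticode s Ah ∧ A = fullBlocksOplusHamming n m l Ah := by
  classical
  have hmpos : ∀ i, 0 < m i := fun i => (hn i).trans_le (hnm i)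
  have hsingle : ∀ i, i < l → ∀ M : Matrix (Fin (n i)) (Fin (m i)) F,
      LinearMap.single F (fun i => Matrix (Fin (n i)) (Fin (m i)) F) i M ∈ A := by
    intro i hi M
    obtain ⟨p, -, -, hp, hpn, -⟩ := exists_finrank_map_proj_eq hnm hmpos hA hdim i
    have htop : A.map (LinearMap.proj i) = ⊤ := Submodule.eq_top_of_finrank_eq (by
      rw [hp, hpn (h2 i hi), Module.finrank_matrix]
      simp [mul_comm])
    obtain ⟨X, hX, rfl⟩ : M ∈ A.map (LinearMap.proj i) := htop ▸ Submodule.mem_top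
    exact single_apply_mem hnm hmpos hA hdim (h2 i hi) hX
  -- membership in `A` depends only on the blocks `i ≥ l`
  have hmem : ∀ X Y : SumRankSpace F n m, Y ∈ A →
      cornerEntries F hn hmpos l X = cornerEntries F hn hmpos l Y → X ∈ A := by
    intro X Y hY hXY
    have : X - Y ∈ A := by
      rw [SumRankSpace.eq_sum_single (X - Y)]
      refine A.sum_mem fun i _ => ?_
      rcases lt_or_ge i l with hi | hi
      · exact hsingle i hi _
      · have h0 : (X - Y) i = 0 := by
          ext a b
          rw [apply_eq_cornerEntries hn hmpos h1 (X - Y) ⟨i, hi⟩ a b, map_sub, hXY, sub_self]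
          rfl
        rw [h0, map_zero]
        exact A.zero_mem
    simpa using A.add_mem this hY
  have hAeq : A = fullBlocksOplusHamming n m l (A.map (cornerEntries F hn hmpos l)) := by
    ext X
    rw [mem_fullBlocksOplusHamming hn hmpos h1]
    constructor
    · exact fun hX => ⟨X, hX, rfl⟩
    · rintro ⟨Y, hY, hYX⟩
      exact hmem X Y hY hYX.symm
  refine ⟨A.map (cornerEntries F hn hmpos l), ⟨?_, ?_⟩, hAeq⟩
  · rintro _ ⟨X, hX, rfl⟩ _ ⟨Y, hY, rfl⟩
    -- the blocks `i < l` of `X - Y` can be replaced with matrices of full rank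
    choose M hM using fun i => exists_rank_eq (F := F) (hnm i) (hmpos i)
    let Z : SumRankSpace F n m := fun i => if l ≤ i then (X - Y) i else M i
    have hZc : cornerEntries F hn hmpos l Z = cornerEntries F hn hmpos l (X - Y) :=
      funext fun k => by rw [cornerEntries_apply, cornerEntries_apply]; simp only [Z, if_pos k.2]
    have hZ := hA Z (hmem Z _ (A.sub_mem hX hY) hZc)
    have hlow : ∑ i ∈ Finset.Iio l, (Z i).rank = ∑ i ∈ Finset.Iio l, n i :=
      Finset.sum_congr rfl fun i hi => by
        simp only [Z, if_neg (not_le.2 (Finset.mem_Iio.1 hi)), hM]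
    rw [srk, sum_eq_sum_Iio_add_sum_subtype l, hlow, sum_rank_eq_hammingNorm hn hmpos h1, hZc,
      map_sub] at hZ
    rw [hammingDist_comm, hammingDist_eq_hammingNorm, neg_add_eq_sub]
    exact Nat.le_of_add_le_add_left hZ
  · have hdim' := finrank_fullBlocksOplusHamming (F := F) hn hmpos h1
      (A.map (cornerEntries F hn hmpos l))
    rw [← hAeq, hdim, threshold_one_eq h1 hmpos] at hdim'
    have hs : Module.finrank F (A.map (cornerEntries F hn hmpos l)) = 1 * s := by omega
    have hcard := (A.map (cornerEntries F hn hmpos l)).finrank_le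
    rw [hs, one_mul, Module.finrank_fintype_fun_eq_card, ← Finset.card_univ] at hcard
    obtain ⟨S, -, hS⟩ := Finset.exists_subset_card_eq hcard
    rw [hs]
    exact isGreatest_boundValues_const (u := fun k => if k ∈ S then 1 else 0)
      (fun k => by split_ifs <;> simp) (by simp [hS])

theorem srk_le_of_mem_fullBlocksOplusHamming (hn : ∀ i, 0 < n i) (hmpos : ∀ i, 0 < m i)
    (h1 : ∀ i, l ≤ i → n i = 1 ∧ m i = 1)
    {Ah : Submodule F ({i : Fin t // l ≤ i} → F)} {s : ℕ} (hAh : IsOptimalHammingAnticode s Ah)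
    {X : SumRankSpace F n m} (hX : X ∈ fullBlocksOplusHamming n m l Ah) :
    srk X ≤ ∑ i ∈ Finset.Iio l, n i + s := by
  classical
  have h := hAh.1 _ ((mem_fullBlocksOplusHamming hn hmpos h1).1 hX) 0 Ah.zero_mem
  rw [hammingDist_zero_right] at h
  rw [srk, sum_eq_sum_Iio_add_sum_subtype l, sum_rank_eq_hammingNorm hn hmpos h1]
  exact Nat.add_le_add (Finset.sum_le_sum fun i _ => (X i).rank_le_height) h

end Hamming

theorem corollary3 {F : Type*} [Field F] {t : ℕ} (n m : Fin t → ℕ)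
    (hn : ∀ i, 0 < n i) (hnm : ∀ i, n i ≤ m i) (hm : Antitone m)
    (r : ℕ) (hr : r < ∑ i, n i) :
    (∃! p : Fin t × ℕ, p.2 < n p.1 ∧ r = ∑ i ∈ Finset.Iio p.1, n i + p.2) ∧
    ∀ (j : Fin t) (δ : ℕ), δ < n j → r = ∑ i ∈ Finset.Iio j, n i + δ →
      -- `l` and `l'` are the first and the last index `i` with `m i = m j`
      ∀ l l' : Fin t, IsLeast {i | m i = m j} l → IsGreatest {i | m i = m j} l' →
        (1 < m j →
          optimalSumRankAnticodes F n m r =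
            {A | ∃ (B : (i : Fin t) → Submodule F (Matrix (Fin (n i)) (Fin (m i)) F))
                (ρ : Fin t → ℕ),
              (∀ i, i < l → B i = ⊤) ∧
              (∀ i ∈ Finset.Icc l l', ρ i ≤ n i ∧ IsOptimalRankAnticode (ρ i) (B i)) ∧
              ∑ i ∈ Finset.Icc l l', ρ i = ∑ i ∈ Finset.Ico l j, n i + δ ∧
              (∀ i, l' < i → B i = ⊥) ∧
              A = Submodule.pi Set.univ B}) ∧
        (m j = 1 →
          optimalSumRankAnticodes F n m r =
            {A | ∃ Ah : Submodule F ({i : Fin t // l ≤ i} → F),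
              IsOptimalHammingAnticode ((j : ℕ) - (l : ℕ)) Ah ∧
              A = fullBlocksOplusHamming n m l Ah}) := by
  refine ⟨existsUnique_partial_sum hr, fun j δ hδ hrj l l' hl hl' => ?_⟩
  have hmpos : ∀ i, 0 < m i := fun i => (hn i).trans_le (hnm i)
  have hlj : l ≤ j := hl.2 rfl
  have hjl' : j ≤ l' := hl'.2 rfl
  have hml : m l = m j := hl.1
  have hml' : m l' = m j := hl'.1
  -- the position of a block relative to `l` and `l'` is the position of `m i` relative to `m j`
  have hlt : ∀ i, i < l → m j < m i := fun i hi =>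
    lt_of_le_of_ne (hml ▸ hm hi.le) fun h => absurd (hl.2 h.symm) (not_le.2 hi)
  have hgt : ∀ i, l' < i → m i < m j := fun i hi =>
    lt_of_le_of_ne (hml' ▸ hm hi.le) fun h => absurd (hl'.2 h) (not_le.2 hi)
  have hlarge : ∀ i, m j < m i → i < l := fun i hi => by
    by_contra! h
    exact absurd (hm h) (by omega)
  have hsmall : ∀ i, m i < m j → l' < i := fun i hi => by
    by_contra! h
    exact absurd (hm h) (by omega)
  have hsplit := sum_Iio_add_sum_Ico (n := n) hlj
  -- the maximum is attained by filling the blocks from the left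
  have hgreatest : IsGreatest (boundValues n m r) (m j * r + ∑ i, (m i - m j) * n i) := by
    set u : Fin t → ℕ := fun i => if i < j then n i else if i = j then δ else 0 with hu
    have hun : ∀ i, u i ≤ n i := fun i => by
      simp only [hu]
      split_ifs with h h'
      · exact le_rfl
      · exact h' ▸ hδ.le
      · exact Nat.zero_le _
    have hur : ∑ i, u i = r := by
      rw [sum_eq_sum_Iio_add_sum_Icc (l := j) (l' := j) fun i hi => by
        simp only [hu, if_neg hi.not_gt, if_neg hi.ne'], Finset.Icc_self, Finset.sum_singleton, hrj]
      congr 1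
      · exact Finset.sum_congr rfl fun i hi => if_pos (Finset.mem_Iio.1 hi)
      · simp [hu]
    have hul : ∀ i, m j < m i → u i = n i := fun i hi =>
      if_pos ((hlarge i hi).trans_le hlj)
    have hus : ∀ i, m i < m j → u i = 0 := fun i hi => by
      have := hjl'.trans_lt (hsmall i hi)
      simp only [hu, if_neg this.not_gt, if_neg this.ne']
    have h := isGreatest_boundValues hun hur hul hus
    rwa [sum_mul_eq_threshold hul hus, hur] at h
  have hdimA : ∀ A ∈ optimalSumRankAnticodes F n m r,
      Module.finrank F A = m j * r + ∑ i, (m i - m j) * n i := fun A hA =>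
    hA.2.unique hgreatest
  constructor
  · intro hmj
    ext A
    constructor
    · intro hA
      have hsrk : ∀ X ∈ A, srk X ≤ r := fun X hX => srk_le_of_mem_optimalSumRankAnticodes hA hX
      choose ρ hρn hρ hρdim hρl hρs using
        exists_finrank_map_proj_eq hnm hmpos hsrk (hdimA A hA)
      have hpi : A = Submodule.pi Set.univ fun i => A.map (LinearMap.proj i) := by
        refine eq_pi_map_proj fun i X hX => ?_
        rcases lt_or_ge (m i) (m j) with hi | hi
        · have h0 : (X i).rank = 0 := Nat.le_zero.1 (hρs i hi ▸ hρ i X hX)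
          have h0' : X i = 0 := (Matrix.toLin' : _ ≃ₗ[F] _).map_eq_zero_iff.1
            (LinearMap.range_eq_bot.1 (Submodule.finrank_eq_zero.1 h0))
          rw [h0', map_zero]
          exact A.zero_mem
        · exact single_apply_mem hnm hmpos hsrk (hdimA A hA) (by omega) hX
      have hρr : ∑ i, ρ i = r := by
        have h1 := hdimA A hA
        rw [hpi, finrank_submodule_pi, Finset.sum_congr rfl fun i _ => hρdim i,
          sum_mul_eq_threshold hρl hρs] at h1
        exact Nat.eq_of_mul_eq_mul_left (hmpos j) (Nat.add_right_cancel h1)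
      refine ⟨fun i => A.map (LinearMap.proj i), ρ, fun i hi => ?_, fun i hi => ⟨hρn i, ?_⟩, ?_,
        fun i hi => ?_, hpi⟩
      · refine Submodule.eq_top_of_finrank_eq ?_
        rw [hρdim, hρl i (hlt i hi), Module.finrank_matrix]
        simp [mul_comm]
      · refine (isOptimalRankAnticode_iff (hρn i)).2 ⟨?_, hρdim i⟩
        rintro _ ⟨X, hX, rfl⟩
        exact hρ i X hX
      · have hlow : ∑ i ∈ Finset.Iio l, ρ i = ∑ i ∈ Finset.Iio l, n i :=
          Finset.sum_congr rfl fun i hi => hρl i (hlt i (Finset.mem_Iio.1 hi))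
        rw [sum_eq_sum_Iio_add_sum_Icc (l := l) fun i hi => hρs i (hgt i hi), hlow] at hρr
        omega
      · refine Submodule.finrank_eq_zero.1 ?_
        rw [hρdim, hρs i (hgt i hi), mul_zero]
    · rintro ⟨B, ρ, hBtop, hB, hρ, hBbot, rfl⟩
      have hmem : ∀ i, ¬ i < l → ¬ l' < i → i ∈ Finset.Icc l l' := fun i h h' =>
        Finset.mem_Icc.2 ⟨not_lt.1 h, not_lt.1 h'⟩
      set ρ' : Fin t → ℕ := fun i => if i < l then n i else if l' < i then 0 else ρ i with hρ'
      have hρs : ∀ i, l' < i → ρ' i = 0 := fun i hi => by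
        simp only [hρ', if_pos hi, if_neg ((hlj.trans hjl').trans_lt hi).not_gt]
      refine pi_mem_optimalSumRankAnticodes (ρ := ρ') (c := m j) (fun i => ?_) (fun i X hX => ?_)
        (fun i => ?_) ?_ (fun i hi => if_pos (hlarge i hi)) fun i hi => hρs i (hsmall i hi)
      · simp only [hρ']
        split_ifs with h h'
        · exact le_rfl
        · exact Nat.zero_le _
        · exact (hB i (hmem i h h')).1
      · simp only [hρ']
        split_ifs with h h'
        · exact X.rank_le_height
        · rw [hBbot i h', Submodule.mem_bot] at hX
          rw [hX, Matrix.rank_zero]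
        · have h1 := hB i (hmem i h h')
          exact ((isOptimalRankAnticode_iff h1.1).1 h1.2).1 X hX
      · simp only [hρ']
        split_ifs with h h'
        · rw [hBtop i h, finrank_top, Module.finrank_matrix]
          simp [mul_comm]
        · rw [hBbot i h', finrank_bot, mul_zero]
        · have h1 := hB i (hmem i h h')
          exact ((isOptimalRankAnticode_iff h1.1).1 h1.2).2
      · have hlow : ∑ i ∈ Finset.Iio l, ρ' i = ∑ i ∈ Finset.Iio l, n i :=
          Finset.sum_congr rfl fun i hi => if_pos (Finset.mem_Iio.1 hi)
        have hcrit : ∑ i ∈ Finset.Icc l l', ρ' i = ∑ i ∈ Finset.Icc l l', ρ i :=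
          Finset.sum_congr rfl fun i hi => by
            rw [Finset.mem_Icc] at hi
            simp only [hρ', if_neg (not_lt.2 hi.1), if_neg (not_lt.2 hi.2)]
        rw [sum_eq_sum_Iio_add_sum_Icc (l := l) hρs, hlow, hcrit, hρ]
        omega
  · intro hmj
    have h1 : ∀ i, l ≤ i → n i = 1 ∧ m i = 1 := fun i hi => by
      have h1 := hm hi
      have h2 := hn i
      have h3 := hnm i
      omega
    have hIco : ∑ i ∈ Finset.Ico l j, n i = (j : ℕ) - l := by
      rw [Finset.sum_congr rfl fun i hi => (h1 i (Finset.mem_Ico.1 hi).1).1]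
      simp
    have hδ0 : δ = 0 := by
      have := (h1 j hlj).1
      omega
    have hrl : r = ∑ i ∈ Finset.Iio l, n i + ((j : ℕ) - l) := by omega
    ext A
    constructor
    · intro hA
      have h2 := hdimA A hA
      rw [hmj, hrl] at h2
      exact exists_eq_fullBlocksOplusHamming hn hnm h1 (fun i hi => hmj ▸ hlt i hi)
        (fun X hX => hrl ▸ srk_le_of_mem_optimalSumRankAnticodes hA hX) h2
    · rintro ⟨Ah, hAh, rfl⟩
      refine ⟨isSumRankAnticode_of_forall_srk_le fun X hX =>
        hrl ▸ srk_le_of_mem_fullBlocksOplusHamming hn hmpos h1 hAh hX, ?_⟩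
      have h2 : Module.finrank F Ah = 1 * ((j : ℕ) - l) := eq_mul_of_mem_boundValues_const hAh.2.1
      rw [finrank_fullBlocksOplusHamming hn hmpos h1, h2, one_mul, ← threshold_one_eq h1 hmpos,
        ← hrl]
      rwa [hmj] at hgreatest
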